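/- **Setting.** Let $G$ be a countable discrete group. A $(C,F)$-sequence is a sequence $\mathcal T=(C_n,F_{n-1})_{n\ge1}$ of pairs of finite subsets of $G$ with $\#F_0=1$ and, for all $n\ge 0$: $\#C_{n+1}>1$, $F_nC_{n+1}\subset F_{n+1}$, and $F_nc\cap F_nc'=\emptyset$ for distinct $c,c'\in C_{n+1}$. Put $X_n=F_n\times C_{n+1}\times C_{n+2}\times\cdots$. The $(C,F)$-space $X=\bigcup_n X_n$ is the inductive limit along the embeddings $(f_n,c_{n+1},c_{n+2},\dots)\mapsto(f_nc_{n+1},c_{n+2},\dots)$ of $X_n$ into $X_{n+1}$. For $A\subset F_n$ let $[A]_n=\{(f_n,c_{n+1},\dots)\in X_n: f_n\in A\}$, and $[f]_n=[\{f\}]_n$. The Haar measure $\mu$ on $X$ is the measure whose restriction to each $X_n$ is $\nu_n\otimes\kappa_{n+1}\otimes\kappa_{n+2}\otimes\cdots$, where $\nu_n(\{f\})=\prod_{i=1}^n(\#C_i)^{-1}$ for $f\in F_n$ and $\kappa_j$ is the equidistribution on $C_j$. For $g\in G$, $T_g(f_n,c_{n+1},\dots)=(gf_n,c_{n+1},\dots)$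 whenever $gf_n\in F_n$. If $\nu_m(gF_nC_{n+1}\cdots C_m\cap F_m)\to\nu_n(F_n)$ as $m\to\infty$ for all $g\in G$, $n\ge0$, then this defines $\mu$-almost everywhere a measure preserving action $T$ of $G$, the $(C,F)$-action associated with $\mathcal T$. For the auxiliary sequences below the condition $\#C_n>1$ is only required for all but finitely many $n$, and $C_n\neq\emptyset$ for the others. *Elementary maps.* * Telescoping: given non-decreasing integers $\boldsymbol l=(l_n)_{n\ge0}$, $l_0=0$, $l_n\to\infty$, the $\boldsymbol l$-telescoping of $\mathcal T$ has the sets $F_{l_n}$ and $C_{l_n+1}\cdots C_{l_{n+1}}$ (this product is $\{1\}$ if $l_n=l_{n+1}$) in place of $F_n$ and $C_{n+1}$, and $\iota_{\boldsymbol l}(f_{l_n},c_{l_n+1},\dots)=(f_{l_n},c_{l_n+1}\cdots c_{l_{n+1}},c_{l_{n+1}+1}\cdots c_{l_{n+2}},\dots)$. * Reduction: given non-empty $A_n\subset C_{n+1}$ ($n\ge0$) with $\sum_n(1-\#A_n/\#C_{n+1})<\infty$, the $\boldsymbol A$-reduction of $\mathcal T$ has the sets $F_n$ and $A_n$ in place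 of $F_n$ and $C_{n+1}$; its space is $X^*=\bigcup_nF_n\times A_n\times A_{n+1}\times\cdots\subset X$, and $\rho_{\boldsymbol A}$ is the map with domain $X^*\subset X$ that sends $x$ to $x$, viewed as a point of the space of the reduction. * Chain equivalence: $\mathcal T$ is chain equivalent to $\mathcal T'=(C'_n,F'_{n-1})_{n\ge1}$ through finite sets $(A_n)_{n\ge0}$, $(B_n)_{n\ge1}$ if for all $n\ge1$: $A_{n-1}B_n=C_n$, $B_nA_n=C_n'$, $F'_{n-1}B_n\subset F_n$, $F_{n-1}A_{n-1}\subset F'_{n-1}$, and $A_{n-1}^{-1}A_{n-1}\cap B_nB_n^{-1}=B_n^{-1}B_n\cap A_nA_n^{-1}=\{1\}$. Then $\psi_{\boldsymbol A,\boldsymbol B}(f_n,a_nb_{n+1},a_{n+1}b_{n+2},\dots)=(f_na_n,b_{n+1}a_{n+1},b_{n+2}a_{n+2},\dots)$, where $a_j\in A_j$, $b_j\in B_j$. **Theorem.** Let $\mathcal T=(C_n,F_{n-1})_{n\ge1}$ and $\widetilde{\mathcal T}=(\widetilde C_n,\widetilde F_{n-1})_{n\ge1}$ be $(C,F)$-sequences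 that satisfy the above limit condition and such that all sets $F_{n-1},C_n,\widetilde F_{n-1},\widetilde C_n$ contain $1$. Let $(X,\mu,T)$ and $(\widetilde X,\widetilde\mu,\widetilde T)$ be the associated actions. Let $(\epsilon_n)_{n\ge0}$ be non-increasing positive reals with $\epsilon_1>1$ and $\sum_{n\ge2}\epsilon_n<\frac13$. Let $\phi:X\to\widetilde X$ be an isomorphism of $T$ with $\widetilde T$, i.e. a nonsingular isomorphism (mod $0$) of the measure spaces with $\phi T_g=\widetilde T_g\phi$ a.e. for each $g\in G$. We say that integers $0=k_0=l_0=k_1<l_1<k_2<l_2<\cdots$ and sets $J_n\subset F_{k_n}$, $\widetilde J_n\subset\widetilde F_{l_n}$ ($n\ge0$) are *produced from $\phi$* if, with $$A_n=\widetilde J_nJ_{n+1}\cap C_{k_n+1}\cdots C_{k_{n+1}},\qquad B_n=J_{n+1}\widetilde J_{n+1}\cap\widetilde C_{l_n+1}\cdots\widetilde C_{l_{n+1}},$$ the following hold for all $n\ge0$: * $F_{k_n}\widetilde J_n\subset\widetilde F_{l_n}$ and $\widetilde F_{l_n}J_{n+1}\subset F_{k_{n+1}}$, and the multiplication maps $F_{k_n}\times\widetilde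 J_n\to\widetilde F_{l_n}$ and $\widetilde F_{l_n}\times J_{n+1}\to F_{k_{n+1}}$ are one-to-one; * $\dfrac{\#(\widetilde J_nJ_{n+1}\,\triangle\, C_{k_n+1}\cdots C_{k_{n+1}})}{\#(C_{k_n+1}\cdots C_{k_{n+1}})}<2\epsilon_n$ and $\dfrac{\#(J_{n+1}\widetilde J_{n+1}\,\triangle\,\widetilde C_{l_n+1}\cdots\widetilde C_{l_{n+1}})}{\#(\widetilde C_{l_n+1}\cdots\widetilde C_{l_{n+1}})}<2\epsilon_n$; * if $n\ge1$, then $\mu([1]_{k_n}\triangle\phi^{-1}([\widetilde J_n]_{l_n}))<\epsilon_n\,\mu([1]_{k_n})$ and $\widetilde\mu([1]_{l_n}\triangle\phi([J_{n+1}]_{k_{n+1}}))<\epsilon_{n+1}\,\widetilde\mu([1]_{l_n})$; * $A_n\ne\emptyset$ and $B_n\neq\emptyset$. Then such data exist. Moreover, for all such data let $\mathcal V$ and $\mathcal W$ be the sequences with the sets $F_{k_n},\ \widetilde J_nJ_{n+1}$ and $\widetilde F_{l_n},\ J_{n+1}\widetilde J_{n+1}$ ($n\ge0$), respectively, in place of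 $F_n,\ C_{n+1}$. Then $\mathcal V$ and $\mathcal W$ are $(C,F)$-sequences (in the above weaker sense); $\boldsymbol A=(A_n)_{n\ge0}$ defines a reduction of the $\boldsymbol k$-telescoping of $\mathcal T$ and a reduction of $\mathcal V$ (these two reductions are the same sequence), with reduction maps $\rho_{\boldsymbol A}$ and $\widehat\rho_{\boldsymbol A}$; $\boldsymbol B=(B_n)_{n\ge0}$ defines a reduction of the $\boldsymbol l$-telescoping of $\widetilde{\mathcal T}$ and a reduction of $\mathcal W$ (again the same sequence), with reduction maps $\rho_{\boldsymbol B}$ and $\widehat\rho_{\boldsymbol B}$; $\mathcal V$ is chain equivalent to $\mathcal W$ through $\widetilde{\boldsymbol J}=(\widetilde J_n)_{n\ge0}$ and $\boldsymbol J=(J_n)_{n\ge1}$; and $$\phi=\iota_{\boldsymbol l}^{-1}\,\rho_{\boldsymbol B}^{-1}\,\widehat\rho_{\boldsymbol B}\,\psi_{\widetilde{\boldsymbol J},\boldsymbol J}\,\widehat\rho_{\boldsymbol A}^{-1}\,\rho_{\boldsymbol A}\,\iota_{\boldsymbol k}\qquad\mu\text{-almost everywhere}$$ (in particular, the right-hand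 side is defined almost everywhere). -/

import Mathlib

open Filter MeasureTheory
open scoped Pointwise symmDiff

/-- The combinatorial data of a `(C,F)`-sequence `(C_n, F_{n-1})_{n ≥ 1}` of finite subsets of `G`.
The indices of the sets `C` are shifted by one: `F n` is `F_n`, whereas `C n` is `C_{n+1}`, the set
of positions of the copies of the `n`-th tower `F n` inside the `(n+1)`-st tower `F (n+1)`. -/
structure CFSeq (G : Type*) where
  F : ℕ → Finset G
  C : ℕ → Finset G

namespace CFSeq

variable {G : Type*} [Group G] [DecidableEq G]

/-! ### `(C,F)`-sequences -/

/-- `𝒯.block m j` is the product set `C_{m+1} C_{m+2} ⋯ C_{m+j}`, which is `{1}` for `j = 0`. -/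
def block (𝒯 : CFSeq G) (m : ℕ) : ℕ → Finset G
  | 0 => {1}
  | j + 1 => 𝒯.block m j * 𝒯.C (m + j)

/-- The conditions on a `(C,F)`-sequence in the form in which also the auxiliary sequences (whose
first sets `C_n` may be singletons) satisfy them: `#C_n > 1` is only required for all but finitely
many `n`, and for the other `n` it is only required that `C_n ≠ ∅`. -/
structure IsWeakCF (𝒯 : CFSeq G) : Prop where
  card_F_zero : (𝒯.F 0).card = 1
  C_nonempty : ∀ n, (𝒯.C n).Nonempty
  eventually_one_lt_card_C : ∀ᶠ n in atTop, 1 < (𝒯.C n).card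
  mul_subset : ∀ n, 𝒯.F n * 𝒯.C n ⊆ 𝒯.F (n + 1)
  disjoint : ∀ n, ∀ c ∈ 𝒯.C n, ∀ c' ∈ 𝒯.C n, c ≠ c' → Disjoint (𝒯.F n * {c}) (𝒯.F n * {c'})

/-- The standard conditions on a `(C,F)`-sequence: `#F_0 = 1` and, for all `n`, `#C_{n+1} > 1`,
`F_n C_{n+1} ⊆ F_{n+1}`, and the sets `F_n c`, `c ∈ C_{n+1}`, are pairwise disjoint. -/
structure IsCF (𝒯 : CFSeq G) : Prop extends 𝒯.IsWeakCF where
  one_lt_card_C : ∀ n, 1 < (𝒯.C n).card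

/-- The normalization `1 ∈ F_n` for `n ≥ 0` and `1 ∈ C_n` for `n ≥ 1`. -/
def IsNormalized (𝒯 : CFSeq G) : Prop :=
  ∀ n, (1 : G) ∈ 𝒯.F n ∧ (1 : G) ∈ 𝒯.C n

/-- The mass `ν_n({f}) = 1 / (#C_1 ⋯ #C_n)` of one level of the `n`-th tower. -/
noncomputable def levelMass (𝒯 : CFSeq G) (n : ℕ) : ℝ :=
  (∏ i ∈ Finset.range n, ((𝒯.C i).card : ℝ))⁻¹

/-- For all `g ∈ G` and `n ≥ 0`,
`ν_m ((g F_n C_{n+1} ⋯ C_m) ∩ F_m) → ν_n (F_n)` as `m → ∞`. This is the condition under which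
almost every point of the `(C,F)`-space can be moved by every `g ∈ G`. -/
def IsMeasurePreserving (𝒯 : CFSeq G) : Prop :=
  ∀ (g : G) (n : ℕ), Tendsto
    (fun m => (((g • (𝒯.F n * 𝒯.block n (m - n))) ∩ 𝒯.F m).card : ℝ) * 𝒯.levelMass m)
    atTop (nhds (((𝒯.F n).card : ℝ) * 𝒯.levelMass n))

/-! ### The `(C,F)`-space -/

/-- The set `X_n = F_n × C_{n+1} × C_{n+2} × ⋯`. -/
abbrev Level (𝒯 : CFSeq G) (n : ℕ) : Type _ :=
  𝒯.F n × ((j : ℕ) → 𝒯.C (n + j))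

/-- `partialProd f c j = f c_0 c_1 ⋯ c_{j-1}`. -/
def partialProd (f : G) (c : ℕ → G) : ℕ → G
  | 0 => f
  | j + 1 => partialProd f c j * c j

/-- To `(f_n, c_{n+1}, c_{n+2}, …) ∈ X_n` we assign the sequence of its coordinates
`m ↦ f_n c_{n+1} ⋯ c_m ∈ F_m`, `m ≥ n`, up to changing finitely many terms. -/
def levelGerm (𝒯 : CFSeq G) (n : ℕ) (p : 𝒯.Level n) : Germ (atTop : Filter ℕ) G :=
  ((fun m => partialProd (p.1 : G) (fun j => (p.2 j : G)) (m - n) : ℕ → G) :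
    Germ (atTop : Filter ℕ) G)

/-- The `(C,F)`-space `X`: the inductive limit of the sets `X_n` along the embeddings
`X_n ∋ (f_n, c_{n+1}, c_{n+2}, …) ↦ (f_n c_{n+1}, c_{n+2}, …) ∈ X_{n+1}`.
It is realized inside the set of germs at infinity of sequences in `G`, a point
`(f_n, c_{n+1}, …)` of `X_n` being identified with the germ of `m ↦ f_n c_{n+1} ⋯ c_m`.
That this is indeed the inductive limit is shown by `toSpace_injective`, `exists_toSpace` and
`toSpace_eq_toSpace_succ_iff`. -/
def Space (𝒯 : CFSeq G) : Type _ :=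
  {u : Germ (atTop : Filter ℕ) G // ∃ (n : ℕ) (p : 𝒯.Level n), 𝒯.levelGerm n p = u}

/-- The canonical embedding of `X_n` into `X`. -/
def toSpace (𝒯 : CFSeq G) (n : ℕ) (p : 𝒯.Level n) : 𝒯.Space :=
  ⟨𝒯.levelGerm n p, n, p, rfl⟩

/-- The cylinder `[A]_n = {(f_n, c_{n+1}, …) ∈ X_n | f_n ∈ A}`. -/
def cylinder (𝒯 : CFSeq G) (n : ℕ) (A : Finset G) : Set 𝒯.Space :=
  {x | ∃ p : 𝒯.Level n, (p.1 : G) ∈ A ∧ 𝒯.toSpace n p = x}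

/-- The Borel `σ`-algebra of `X`; the cylinders are a countable base of the topology of `X`. -/
instance instMeasurableSpaceSpace (𝒯 : CFSeq G) : MeasurableSpace 𝒯.Space :=
  MeasurableSpace.generateFrom {s | ∃ (n : ℕ) (A : Finset G), s = 𝒯.cylinder n A}

/-- The discrete `σ`-algebra on a finite subset of `G`. -/
@[reducible] def finsetMeasurableSpace (s : Finset G) : MeasurableSpace s := ⊤

section Haar

attribute [local instance] finsetMeasurableSpace

/-- The measure `ν_n ⊗ κ_{n+1} ⊗ κ_{n+2} ⊗ ⋯` on `X_n`, where `ν_n` gives the mass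
`1 / (#C_1 ⋯ #C_n)` to each point of `F_n` and `κ_j` is the equidistribution on `C_j`. -/
noncomputable def levelMeasure (𝒯 : CFSeq G) [∀ n, Nonempty (𝒯.C n)] (n : ℕ) :
    Measure (𝒯.Level n) :=
  (ENNReal.ofReal (𝒯.levelMass n) • (Measure.count : Measure (𝒯.F n))).prod
    (Measure.infinitePi fun j : ℕ => (PMF.uniformOfFintype (𝒯.C (n + j))).toMeasure)

open Classical in
/-- The Haar measure `μ` of the `(C,F)`-space `X`: the measure whose restriction to `X_n` is
`ν_n ⊗ κ_{n+1} ⊗ κ_{n+2} ⊗ ⋯`, for every `n`. It is obtained by gluing these measures along the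
partition of `X` into the sets `X_n ∖ (X_0 ∪ ⋯ ∪ X_{n-1})`. (All `C_n` are non-empty in a
`(C,F)`-sequence; the value `0` otherwise is a convention.) -/
noncomputable def haar (𝒯 : CFSeq G) : Measure 𝒯.Space :=
  if h : ∀ n, (𝒯.C n).Nonempty then
    haveI : ∀ n, Nonempty (𝒯.C n) := fun n => (h n).to_subtype
    Measure.sum fun n =>
      ((𝒯.levelMeasure n).map (𝒯.toSpace n)).restrict
        (disjointed (fun m => Set.range (𝒯.toSpace m)) n)
  else 0

end Haar

/-! ### Partial maps, the action, and the elementary maps -/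

open Classical in
/-- The partial map `X → X'` induced by a transformation `Φ` of germs:
`x` is in the domain if `Φ x` is a point of `X'`, and then the value at `x` is `Φ x`. -/
noncomputable def partialMap (𝒯 𝒯' : CFSeq G)
    (Φ : Germ (atTop : Filter ℕ) G → Germ (atTop : Filter ℕ) G) : 𝒯.Space →. 𝒯'.Space :=
  fun x => ⟨∃ (n : ℕ) (p : 𝒯'.Level n), 𝒯'.levelGerm n p = Φ x.1, fun h => ⟨Φ x.1, h⟩⟩

/-- The inverse of an injective partial map `f`. For any `f`, a point `b` is in the domain if it has
exactly one preimage under `f`, and then the value at `b` is this preimage. -/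
noncomputable def partialInverse {α β : Type*} (f : α →. β) : β →. α :=
  fun b => ⟨∃! a, b ∈ f a, fun h => h.choose⟩

/-- The `(C,F)`-action: `T_g (f_n, c_{n+1}, …) = (g f_n, c_{n+1}, …)`, defined for those points `x`
that have coordinates `x = (f_n, c_{n+1}, …) ∈ X_n` with `g f_n ∈ F_n`, for some `n`. -/
noncomputable def act (𝒯 : CFSeq G) (g : G) : 𝒯.Space →. 𝒯.Space :=
  partialMap 𝒯 𝒯 (Germ.map fun s => g * s)

/-- The telescoping of `𝒯` along `l`: `F_n` is replaced by `F_{l_n}` and `C_{n+1}` by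
`C_{l_n + 1} ⋯ C_{l_{n+1}}`. -/
def telescope (𝒯 : CFSeq G) (l : ℕ → ℕ) : CFSeq G where
  F n := 𝒯.F (l n)
  C n := 𝒯.block (l n) (l (n + 1) - l n)

/-- The telescoping mapping
`ι (f_{l_n}, c_{l_n + 1}, …) = (f_{l_n}, c_{l_n + 1} ⋯ c_{l_{n+1}}, c_{l_{n+1} + 1} ⋯ c_{l_{n+2}}, …)`;
on germs it is the restriction to the subsequence `l`. -/
noncomputable def telescopeMap (𝒯 : CFSeq G) (l : ℕ → ℕ) (hl : Tendsto l atTop atTop) :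
    𝒯.Space →. (𝒯.telescope l).Space :=
  partialMap 𝒯 (𝒯.telescope l) fun u => u.compTendsto l hl

/-- The reduction of `𝒯`: the sets `C_n` are replaced by `A_n` (`A n` stands for `A_{n+1}`). -/
def reduce (𝒯 : CFSeq G) (A : ℕ → Finset G) : CFSeq G where
  F := 𝒯.F
  C := A

/-- The sets `A_n` define a reduction of `𝒯`: they are non-empty subsets of the sets `C_n`, and
`∑ (1 - #A_n / #C_n) < ∞`. -/
structure IsReduction (𝒯 : CFSeq G) (A : ℕ → Finset G) : Prop where
  nonempty : ∀ n, (A n).Nonempty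
  subset : ∀ n, A n ⊆ 𝒯.C n
  summable : Summable fun n => 1 - ((A n).card : ℝ) / ((𝒯.C n).card : ℝ)

/-- The reduction mapping `ρ_A`. Its domain is the subset `X* = ⋃_n F_n × A_{n+1} × A_{n+2} × ⋯`
of `X`, and `ρ_A x = x`, viewed as a point of the `(C,F)`-space `X*`, for `x` in the domain. -/
noncomputable def reductionMap (𝒯 : CFSeq G) (A : ℕ → Finset G) :
    𝒯.Space →. (𝒯.reduce A).Space :=
  partialMap 𝒯 (𝒯.reduce A) id

/-- `𝒯` is chain equivalent to `𝒯'` through the sequences `A` and `B`. The indices of the sets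
`B` are shifted: `A n` is `A_n`, and `B n` is `B_{n+1}`. -/
structure IsChainEquivalent (𝒯 𝒯' : CFSeq G) (A B : ℕ → Finset G) : Prop where
  mul_eq : ∀ n, A n * B n = 𝒯.C n
  mul_eq' : ∀ n, B n * A (n + 1) = 𝒯'.C n
  subset' : ∀ n, 𝒯'.F n * B n ⊆ 𝒯.F (n + 1)
  subset : ∀ n, 𝒯.F n * A n ⊆ 𝒯'.F n
  inter : ∀ n, ((A n)⁻¹ * A n) ∩ (B n * (B n)⁻¹) = {1}
  inter' : ∀ n, ((B n)⁻¹ * B n) ∩ (A (n + 1) * (A (n + 1))⁻¹) = {1}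

open Classical in
/-- The factor `a ∈ A` of an element `c = a b` of the product `A B` (which is unique in the
situations where it is used); `1` if `c ∉ A B`. -/
noncomputable def leftFactor (A B : Finset G) (c : G) : G :=
  if h : ∃ a ∈ A, ∃ b ∈ B, c = a * b then h.choose else 1

/-- The transformation of germs underlying a chain equivalence. If
`u_n = f_n`, `u_n⁻¹ u_{n+1} = c_{n+1} = a_n b_{n+1}` then the image is `v_n = f_n a_n`,
and thus `v_n⁻¹ v_{n+1} = b_{n+1} a_{n+1}`. -/
noncomputable def chainGerm (A B : ℕ → Finset G) :
    Germ (atTop : Filter ℕ) G → Germ (atTop : Filter ℕ) G :=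
  Germ.map' (fun (u : ℕ → G) n => u n * leftFactor (A n) (B n) ((u n)⁻¹ * u (n + 1))) (by
    intro u v huv
    have h : ∀ᶠ n in atTop, u n = v n := huv
    have h' : ∀ᶠ n in atTop, u (n + 1) = v (n + 1) := (tendsto_add_atTop_nat 1).eventually h
    filter_upwards [h, h'] with n h1 h2
    rw [h1, h2])

/-- The chain equivalence
`ψ_{A,B} (f_n, a_n b_{n+1}, a_{n+1} b_{n+2}, …) = (f_n a_n, b_{n+1} a_{n+1}, b_{n+2} a_{n+2}, …)`,
where `a_j ∈ A_j` and `b_j ∈ B_j`. -/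
noncomputable def chainMap (𝒯 𝒯' : CFSeq G) (A B : ℕ → Finset G) : 𝒯.Space →. 𝒯'.Space :=
  partialMap 𝒯 𝒯' (chainGerm A B)

/-! ### Isomorphisms, and the data linking two `(C,F)`-sequences -/

/-- An isomorphism (mod 0) between the `(C,F)`-actions associated with `𝒯` and `𝒯'`: a nonsingular
isomorphism `φ` of the measure spaces with `φ (T_g x) = T'_g (φ x)` for almost every `x`. -/
structure ActionIso (𝒯 𝒯' : CFSeq G) where
  toFun : 𝒯.Space → 𝒯'.Space
  invFun : 𝒯'.Space → 𝒯.Space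
  quasi : Measure.QuasiMeasurePreserving toFun 𝒯.haar 𝒯'.haar
  quasi_inv : Measure.QuasiMeasurePreserving invFun 𝒯'.haar 𝒯.haar
  left_inv : ∀ᵐ x ∂𝒯.haar, invFun (toFun x) = x
  right_inv : ∀ᵐ y ∂𝒯'.haar, toFun (invFun y) = y
  equivariant : ∀ g : G, ∀ᵐ x ∂𝒯.haar, ∃ y ∈ 𝒯.act g x, toFun y ∈ 𝒯'.act g (toFun x)

/-- Sequences `0 = k_0 = l_0 = k_1 < l_1 < k_2 < l_2 < ⋯` and sets `J_n ⊆ F_{k_n}`,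
`J'_n ⊆ F'_{l_n}` such that the products `F_{k_n} J'_n ⊆ F'_{l_n}` and
`F'_{l_n} J_{n+1} ⊆ F_{k_{n+1}}` are direct. -/
structure LinkingData (𝒯 𝒯' : CFSeq G) where
  k : ℕ → ℕ
  l : ℕ → ℕ
  J : ℕ → Finset G
  J' : ℕ → Finset G
  k_zero : k 0 = 0
  l_zero : l 0 = 0
  k_one : k 1 = 0
  k_lt_l : ∀ n, 1 ≤ n → k n < l n
  l_lt_k : ∀ n, 1 ≤ n → l n < k (n + 1)
  J_subset : ∀ n, J n ⊆ 𝒯.F (k n)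
  J'_subset : ∀ n, J' n ⊆ 𝒯'.F (l n)
  mul_J'_subset : ∀ n, 𝒯.F (k n) * J' n ⊆ 𝒯'.F (l n)
  mul_J'_injOn : ∀ n, Set.InjOn (fun p : G × G => p.1 * p.2) (𝒯.F (k n) ×ˢ J' n : Finset (G × G))
  mul_J_subset : ∀ n, 𝒯'.F (l n) * J (n + 1) ⊆ 𝒯.F (k (n + 1))
  mul_J_injOn : ∀ n,
    Set.InjOn (fun p : G × G => p.1 * p.2) (𝒯'.F (l n) ×ˢ J (n + 1) : Finset (G × G))

namespace LinkingData

variable {𝒯 𝒯' : CFSeq G} (D : LinkingData 𝒯 𝒯')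

theorem le_k_succ (n : ℕ) : n ≤ D.k (n + 1) := by
  induction n with
  | zero => exact Nat.zero_le _
  | succ n ih =>
    have h1 := D.k_lt_l (n + 1) (by omega)
    have h2 := D.l_lt_k (n + 1) (by omega)
    omega

theorem le_l (n : ℕ) : n ≤ D.l n := by
  rcases n with _ | n
  · exact Nat.zero_le _
  · have h1 := D.le_k_succ n
    have h2 := D.k_lt_l (n + 1) (by omega)
    omega

theorem tendsto_k : Tendsto D.k atTop atTop :=
  (tendsto_add_atTop_iff_nat 1).1 (tendsto_atTop_mono D.le_k_succ tendsto_id)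

theorem tendsto_l : Tendsto D.l atTop atTop :=
  tendsto_atTop_mono D.le_l tendsto_id

/-- The `(C,F)`-sequence `𝒱` with the towers `F_{k_n}` and the sets `J'_n J_{n+1}`, `n ≥ 0`. -/
def V : CFSeq G where
  F n := 𝒯.F (D.k n)
  C n := D.J' n * D.J (n + 1)

/-- The `(C,F)`-sequence `𝒲` with the towers `F'_{l_n}` and the sets `J_{n+1} J'_{n+1}`, `n ≥ 0`. -/
def W : CFSeq G where
  F n := 𝒯'.F (D.l n)
  C n := D.J (n + 1) * D.J' (n + 1)

/-- `A_n = (J'_n J_{n+1}) ∩ (C_{k_n + 1} ⋯ C_{k_{n+1}})`, `n ≥ 0`. -/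
def A (n : ℕ) : Finset G :=
  (D.J' n * D.J (n + 1)) ∩ (𝒯.telescope D.k).C n

/-- `B_n = (J_{n+1} J'_{n+1}) ∩ (C'_{l_n + 1} ⋯ C'_{l_{n+1}})`, `n ≥ 0`. -/
def B (n : ℕ) : Finset G :=
  (D.J (n + 1) * D.J' (n + 1)) ∩ (𝒯'.telescope D.l).C n

/-- The data `D` arise from the isomorphism `φ`, with the error bounds `ε`. The first two conditions
are the approximate equalities of `J'_n J_{n+1}` with `C_{k_n + 1} ⋯ C_{k_{n+1}}` and of
`J_{n+1} J'_{n+1}` with `C'_{l_n + 1} ⋯ C'_{l_{n+1}}`. The next two say that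
`φ⁻¹ [J'_n]_{l_n}` approximates `[1]_{k_n}` and that `φ [J_{n+1}]_{k_{n+1}}` approximates
`[1]_{l_n}`. Finally, the sets `A_n` and `B_n` are required to be non-empty, as it is necessary for
the reductions to be defined. -/
structure IsProducedFrom (φ : ActionIso 𝒯 𝒯') (ε : ℕ → ℝ) : Prop where
  card_symmDiff_lt : ∀ n,
    (((D.J' n * D.J (n + 1)) ∆ (𝒯.telescope D.k).C n).card : ℝ) /
      (((𝒯.telescope D.k).C n).card : ℝ) < 2 * ε n
  card_symmDiff_lt' : ∀ n,
    (((D.J (n + 1) * D.J' (n + 1)) ∆ (𝒯'.telescope D.l).C n).card : ℝ) /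
      (((𝒯'.telescope D.l).C n).card : ℝ) < 2 * ε n
  haar_symmDiff_lt : ∀ n, 1 ≤ n →
    𝒯.haar (𝒯.cylinder (D.k n) {1} ∆ (φ.toFun ⁻¹' 𝒯'.cylinder (D.l n) (D.J' n))) <
      ENNReal.ofReal (ε n) * 𝒯.haar (𝒯.cylinder (D.k n) {1})
  haar_symmDiff_lt' : ∀ n, 1 ≤ n →
    𝒯'.haar (𝒯'.cylinder (D.l n) {1} ∆
        (φ.invFun ⁻¹' 𝒯.cylinder (D.k (n + 1)) (D.J (n + 1)))) <
      ENNReal.ofReal (ε (n + 1)) * 𝒯'.haar (𝒯'.cylinder (D.l n) {1})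
  A_nonempty : ∀ n, (D.A n).Nonempty
  B_nonempty : ∀ n, (D.B n).Nonempty

/-- The composition of seven elementary maps
`ι_l⁻¹ ∘ ρ_B⁻¹ ∘ ρ̂_B ∘ ψ_{J',J} ∘ ρ̂_A⁻¹ ∘ ρ_A ∘ ι_k`. Here the `A`-reduction of the `k`-telescoping
of `𝒯` is the same `(C,F)`-sequence as the `A`-reduction of `𝒱`, and the `B`-reduction of the
`l`-telescoping of `𝒯'` is the same `(C,F)`-sequence as the `B`-reduction of `𝒲`. -/
noncomputable def composition : 𝒯.Space →. 𝒯'.Space :=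
  (partialInverse (𝒯'.telescopeMap D.l D.tendsto_l)).comp <|
  (partialInverse ((𝒯'.telescope D.l).reductionMap D.B)).comp <|
  PFun.comp (β := D.W.Space) (D.W.reductionMap D.B) <|
  (chainMap D.V D.W D.J' (fun n => D.J (n + 1))).comp <|
  (partialInverse (D.V.reductionMap D.A)).comp <|
  PFun.comp (β := (𝒯.telescope D.k).Space) ((𝒯.telescope D.k).reductionMap D.A) <|
  𝒯.telescopeMap D.k D.tendsto_k

end LinkingData

/-! ### The `(C,F)`-space is the inductive limit of the sets `X_n` -/

theorem exists_toSpace (𝒯 : CFSeq G) (x : 𝒯.Space) : ∃ n p, 𝒯.toSpace n p = x := by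
  obtain ⟨u, n, p, h⟩ := x
  exact ⟨n, p, Subtype.ext h⟩

theorem partialProd_mem {𝒯 : CFSeq G} (h : 𝒯.IsWeakCF) {n : ℕ} (p : 𝒯.Level n) (j : ℕ) :
    partialProd (p.1 : G) (fun j => (p.2 j : G)) j ∈ 𝒯.F (n + j) := by
  induction j with
  | zero => exact p.1.2
  | succ j ih => exact h.mul_subset _ (Finset.mul_mem_mul ih (p.2 j).2)

theorem IsWeakCF.cancel {𝒯 : CFSeq G} (h : 𝒯.IsWeakCF) {n : ℕ} {f f' c c' : G}
    (hf : f ∈ 𝒯.F n) (hf' : f' ∈ 𝒯.F n) (hc : c ∈ 𝒯.C n) (hc' : c' ∈ 𝒯.C n)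
    (e : f * c = f' * c') : f = f' ∧ c = c' := by
  by_cases hcc : c = c'
  · subst hcc
    exact ⟨mul_right_cancel e, rfl⟩
  · exact absurd (e ▸ Finset.mul_mem_mul hf' (Finset.mem_singleton_self c'))
      (Finset.disjoint_left.1 (h.disjoint n c hc c' hc' hcc)
        (Finset.mul_mem_mul hf (Finset.mem_singleton_self c)))

theorem toSpace_injective {𝒯 : CFSeq G} (h : 𝒯.IsWeakCF) (n : ℕ) :
    Function.Injective (𝒯.toSpace n) := by
  intro p q hpq
  have hg : 𝒯.levelGerm n p = 𝒯.levelGerm n q := congrArg Subtype.val hpq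
  rw [levelGerm, levelGerm, Germ.coe_eq] at hg
  obtain ⟨N, hN⟩ := eventually_atTop.1 hg
  have key : ∀ d j, j + d = N + 1 →
      partialProd (p.1 : G) (fun j => (p.2 j : G)) j =
        partialProd (q.1 : G) (fun j => (q.2 j : G)) j := by
    intro d
    induction d with
    | zero =>
      intro j hj
      have := hN (n + j) (by omega)
      simpa using this
    | succ d ih =>
      intro j hj
      exact (h.cancel (partialProd_mem h p j) (partialProd_mem h q j) (p.2 j).2 (q.2 j).2
        (ih (j + 1) (by omega))).1
  have key' : ∀ j, partialProd (p.1 : G) (fun j => (p.2 j : G)) j =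
      partialProd (q.1 : G) (fun j => (q.2 j : G)) j := by
    intro j
    rcases le_or_gt j (N + 1) with hj | hj
    · exact key (N + 1 - j) j (by omega)
    · have := hN (n + j) (by omega)
      simpa using this
  refine Prod.ext (Subtype.ext (key' 0)) (funext fun j => Subtype.ext ?_)
  have h1 := key' (j + 1)
  rw [partialProd, partialProd, key' j] at h1
  exact mul_left_cancel h1

theorem toSpace_eq_toSpace_succ_iff {𝒯 : CFSeq G} (h : 𝒯.IsWeakCF) (n : ℕ)
    (p : 𝒯.Level n) (q : 𝒯.Level (n + 1)) :
    𝒯.toSpace n p = 𝒯.toSpace (n + 1) q ↔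
      (q.1 : G) = p.1 * p.2 0 ∧ ∀ j, (q.2 j : G) = p.2 (j + 1) := by
  have aux : ∀ (p : 𝒯.Level n) (q : 𝒯.Level (n + 1)),
      ((q.1 : G) = p.1 * p.2 0 ∧ ∀ j, (q.2 j : G) = p.2 (j + 1)) →
        𝒯.toSpace n p = 𝒯.toSpace (n + 1) q := by
    rintro p q ⟨h0, h1⟩
    have key : ∀ j, partialProd (p.1 : G) (fun j => (p.2 j : G)) (j + 1) =
        partialProd (q.1 : G) (fun j => (q.2 j : G)) j := by
      intro j
      induction j with
      | zero => exact h0.symm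
      | succ j ih => rw [partialProd, ih, partialProd, h1 j]
    refine Subtype.ext (Germ.coe_eq.2 (eventually_atTop.2 ⟨n + 1, fun m hm => ?_⟩))
    obtain ⟨i, rfl⟩ := Nat.exists_eq_add_of_le hm
    have h2 : n + 1 + i - n = i + 1 := by omega
    have h3 : n + 1 + i - (n + 1) = i := by omega
    simp only [h2, h3]
    exact key i
  refine ⟨fun e => ?_, aux p q⟩
  let q' : 𝒯.Level (n + 1) :=
    (⟨p.1 * p.2 0, h.mul_subset n (Finset.mul_mem_mul p.1.2 (p.2 0).2)⟩,
      fun j => ⟨p.2 (j + 1), by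
        have e : n + 1 + j = n + (j + 1) := by omega
        rw [e]
        exact (p.2 (j + 1)).2⟩)
  have hq : q = q' := toSpace_injective h (n + 1) (e.symm.trans (aux p q' ⟨rfl, fun _ => rfl⟩))
  subst hq
  exact ⟨rfl, fun _ => rfl⟩

end CFSeq

/-! A point of the space is the germ of its coordinates `u n ∈ F n`, and `T_g` multiplies the germ
by `g` on the left. The levels of a tower are translates of one another, so an invariant measure
that is finite on `X_0` is determined by its mass there. Applied to the sublevel sets of a density,
this shows that every absolutely continuous `σ`-finite invariant measure is a multiple of Haar
measure (`IsStandard.exists_eq_smul_haar`). Hence `φ` multiplies Haar measure by a constant, and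
`φ⁻¹[1]_l` has finite measure and is nearly a cylinder `[J]_m`.

The translates of `φ⁻¹[1]_l` by the elements of `F'_l` are disjoint mod 0. Therefore few elements of
`J` violate directness of the product `F'_l J`, and they can be removed
(`ActionIso.exists_cylinder_approx_injOn`). Alternating between `φ` and `φ⁻¹` gives `[1]_{k_n} ≈
φ⁻¹[J'_n]_{l_n} ≈ [J'_n J_{n+1}]_{k_{n+1}}`. As `[1]_{k_n}` is also the cylinder over `C_{k_n+1} ⋯
C_{k_{n+1}}`, counting levels compares this product with `J'_n J_{n+1}`
(`ActionIso.exists_half_step`).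

For the formula, let `u` and `v` be the coordinates of `x` and `φ x`. The errors are summable, so by
Borel–Cantelli (`ActionIso.ae_eventually_linked`), for almost every `x` and all large `n`, `v_{l_n}
∈ u_{k_n} J'_n` and `u_{k_{n+1}} ∈ v_{l_n} J_{n+1}`. So the step from `u_{k_n}` to `u_{k_{n+1}}` is
a product `j' j` with `u_{k_n} j' = v_{l_n}`, and the chain equivalence turns `u` along `k` into `v`
along `l` (`LinkingData.mem_composition`). -/

set_option linter.unusedSectionVars false

namespace CFSeq

variable {G : Type*} [Group G] [DecidableEq G]

/-! ### Coordinates of points of the `(C,F)`-space -/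

/-- From the index `N` on, the sequence `u` consists of the coordinates of a point of `X_N`. -/
structure IsPath (𝒯 : CFSeq G) (u : ℕ → G) (N : ℕ) : Prop where
  mem : u N ∈ 𝒯.F N
  step : ∀ n, N ≤ n → (u n)⁻¹ * u (n + 1) ∈ 𝒯.C n

namespace IsPath

variable {𝒯 : CFSeq G} {u v : ℕ → G} {N n : ℕ}

theorem mem_F (hu : 𝒯.IsPath u N) (h : 𝒯.IsWeakCF) (hn : N ≤ n) : u n ∈ 𝒯.F n := by
  induction n, hn using Nat.le_induction with
  | base => exact hu.mem
  | succ n hn ih =>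
    have := Finset.mul_mem_mul ih (hu.step n hn)
    rw [mul_inv_cancel_left] at this
    exact h.mul_subset n this

theorem mono (hu : 𝒯.IsPath u N) (h : 𝒯.IsWeakCF) (hn : N ≤ n) : 𝒯.IsPath u n :=
  ⟨hu.mem_F h hn, fun m hm => hu.step m (hn.trans hm)⟩

theorem exists_level (hu : 𝒯.IsPath u N) :
    ∃ p : 𝒯.Level N, (p.1 : G) = u N ∧ 𝒯.levelGerm N p = (u : Germ (atTop : Filter ℕ) G) := by
  refine ⟨(⟨u N, hu.mem⟩, fun j => ⟨(u (N + j))⁻¹ * u (N + j + 1), hu.step _ (by omega)⟩),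
    rfl, Germ.coe_eq.2 (eventually_atTop.2 ⟨N, fun m hm => ?_⟩)⟩
  obtain ⟨j, rfl⟩ := Nat.exists_eq_add_of_le hm
  simp only [Nat.add_sub_cancel_left]
  induction j with
  | zero => rfl
  | succ j ih => rw [partialProd, ih (by omega), mul_inv_cancel_left]; rfl

/-- The point with the coordinates `u`. -/
def point (hu : 𝒯.IsPath u N) : 𝒯.Space :=
  ⟨u, N, hu.exists_level.choose, hu.exists_level.choose_spec.2⟩

/-- Multiplication is injective on `F n × C n`, so a coordinate determines all earlier ones. This
makes the telescoping map injective. -/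
theorem eq_of_le (hu : 𝒯.IsPath u N) (hv : 𝒯.IsPath v N) (h : 𝒯.IsWeakCF) {m : ℕ}
    (hm : u m = v m) (hn : N ≤ n) (hnm : n ≤ m) : u n = v n := by
  induction m, hnm using Nat.le_induction with
  | base => exact hm
  | succ m hnm ih =>
    refine ih (h.cancel (hu.mem_F h (hn.trans hnm)) (hv.mem_F h (hn.trans hnm))
      (hu.step m (hn.trans hnm)) (hv.step m (hn.trans hnm)) ?_).1
    rw [mul_inv_cancel_left, mul_inv_cancel_left, hm]

theorem mem_block (hu : 𝒯.IsPath u N) (hn : N ≤ n) (j : ℕ) :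
    (u n)⁻¹ * u (n + j) ∈ 𝒯.block n j := by
  induction j with
  | zero => simp [block, Finset.singleton_one]
  | succ j ih =>
    have := Finset.mul_mem_mul ih (hu.step (n + j) (by omega))
    rwa [mul_assoc, mul_inv_cancel_left] at this

end IsPath

variable {𝒯 𝒯' : CFSeq G}

theorem isPath_partialProd {n : ℕ} (p : 𝒯.Level n) :
    𝒯.IsPath (fun m => partialProd (p.1 : G) (fun j => (p.2 j : G)) (m - n)) n := by
  refine ⟨by simp [partialProd], fun m hm => ?_⟩
  obtain ⟨j, rfl⟩ := Nat.exists_eq_add_of_le hm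
  have h1 : n + j + 1 - n = j + 1 := by omega
  simp only [Nat.add_sub_cancel_left, h1, partialProd, inv_mul_cancel_left]
  exact (p.2 j).2

theorem exists_path (x : 𝒯.Space) :
    ∃ N u, 𝒯.IsPath u N ∧ x.1 = (u : Germ (atTop : Filter ℕ) G) := by
  obtain ⟨n, p, hp⟩ := x.2
  exact ⟨n, _, isPath_partialProd p, hp.symm⟩

/-! ### Cylinders in terms of coordinates -/

theorem mem_cylinder_iff (h : 𝒯.IsWeakCF) {u : ℕ → G} {N n : ℕ} (hu : 𝒯.IsPath u N)
    {x : 𝒯.Space} (hx : x.1 = (u : Germ (atTop : Filter ℕ) G)) (hn : N ≤ n) (A : Finset G) :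
    x ∈ 𝒯.cylinder n A ↔ u n ∈ A := by
  obtain ⟨p, hp, hpu⟩ := (hu.mono h hn).exists_level
  have hpx : 𝒯.toSpace n p = x := Subtype.ext (hpu.trans hx.symm)
  constructor
  · rintro ⟨q, hq, hqx⟩
    rwa [← hp, toSpace_injective h n (hpx.trans hqx.symm)]
  · exact fun hA => ⟨p, hp ▸ hA, hpx⟩

theorem exists_path_of_mem_cylinder {n : ℕ} {A : Finset G} {x : 𝒯.Space}
    (hx : x ∈ 𝒯.cylinder n A) :
    ∃ u, 𝒯.IsPath u n ∧ u n ∈ A ∧ x.1 = (u : Germ (atTop : Filter ℕ) G) := by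
  obtain ⟨p, hA, hp⟩ := hx
  exact ⟨_, isPath_partialProd p, by simpa [partialProd] using hA, hp ▸ rfl⟩

theorem cylinder_inter_F (n : ℕ) (A : Finset G) :
    𝒯.cylinder n (A ∩ 𝒯.F n) = 𝒯.cylinder n A := by
  ext x
  constructor
  · rintro ⟨p, hA, hp⟩
    exact ⟨p, (Finset.mem_inter.1 hA).1, hp⟩
  · rintro ⟨p, hA, hp⟩
    exact ⟨p, Finset.mem_inter.2 ⟨hA, p.1.2⟩, hp⟩

theorem cylinder_succ (h : 𝒯.IsWeakCF) {n : ℕ} {A : Finset G} (hA : A ⊆ 𝒯.F n) :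
    𝒯.cylinder (n + 1) (A * 𝒯.C n) = 𝒯.cylinder n A := by
  ext x
  constructor
  · intro hx
    obtain ⟨u, hu, huA, hxu⟩ := exists_path_of_mem_cylinder hx
    obtain ⟨f, hf, c, hc, hfc⟩ := Finset.mem_mul.1 huA
    -- The path starts at `n + 1` with `u (n + 1) = f * c`. Putting `f` at `n` extends it one level
    -- down, and changing a single term does not affect the germ.
    have key : ∀ m, n < m → Function.update u n f m = u m := fun m hm =>
      Function.update_of_ne hm.ne' f u
    have hu' : 𝒯.IsPath (Function.update u n f) n := by
      refine ⟨by simpa using hA hf, fun m hm => ?_⟩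
      rcases hm.eq_or_lt with rfl | hm
      · rw [key _ (Nat.lt_succ_self _), Function.update_self, ← hfc, inv_mul_cancel_left]
        exact hc
      · rw [key _ hm, key _ (by omega)]
        exact hu.step m hm
    refine (mem_cylinder_iff h hu' ?_ le_rfl A).2 (by simpa using hf)
    rw [hxu]
    exact Germ.coe_eq.2 (eventually_atTop.2 ⟨n + 1, fun m hm => (key m hm).symm⟩)
  · intro hx
    obtain ⟨u, hu, huA, hxu⟩ := exists_path_of_mem_cylinder hx
    refine (mem_cylinder_iff h hu hxu n.le_succ _).2 ?_
    have := Finset.mul_mem_mul huA (hu.step n le_rfl)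
    rwa [mul_inv_cancel_left] at this

theorem mul_block_subset (h : 𝒯.IsWeakCF) {n : ℕ} {A : Finset G} (hA : A ⊆ 𝒯.F n) (j : ℕ) :
    A * 𝒯.block n j ⊆ 𝒯.F (n + j) := by
  induction j with
  | zero => simpa [block, Finset.singleton_one] using hA
  | succ j ih =>
    rw [block, ← mul_assoc]
    exact (Finset.mul_subset_mul_right ih).trans (h.mul_subset (n + j))

theorem cylinder_add (h : 𝒯.IsWeakCF) {n : ℕ} {A : Finset G} (hA : A ⊆ 𝒯.F n) (j : ℕ) :
    𝒯.cylinder (n + j) (A * 𝒯.block n j) = 𝒯.cylinder n A := by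
  induction j with
  | zero => simp [block, Finset.singleton_one]
  | succ j ih =>
    rw [block, ← mul_assoc, ← ih]
    exact cylinder_succ h (mul_block_subset h hA j)

theorem mul_block_subset' (h : 𝒯.IsWeakCF) {n m : ℕ} (hnm : n ≤ m) {A : Finset G}
    (hA : A ⊆ 𝒯.F n) : A * 𝒯.block n (m - n) ⊆ 𝒯.F m := by
  obtain ⟨j, rfl⟩ := Nat.exists_eq_add_of_le hnm
  simpa using mul_block_subset h hA j

theorem cylinder_of_le (h : 𝒯.IsWeakCF) {n m : ℕ} (hnm : n ≤ m) {A : Finset G}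
    (hA : A ⊆ 𝒯.F n) : 𝒯.cylinder m (A * 𝒯.block n (m - n)) = 𝒯.cylinder n A := by
  obtain ⟨j, rfl⟩ := Nat.exists_eq_add_of_le hnm
  simpa using cylinder_add h hA j

/-! ### Counting levels, and the level masses -/

theorem block_nonempty (h : 𝒯.IsWeakCF) (n j : ℕ) : (𝒯.block n j).Nonempty := by
  induction j with
  | zero => exact Finset.singleton_nonempty 1
  | succ j ih => exact ih.mul (h.C_nonempty _)

theorem F_nonempty (h : 𝒯.IsWeakCF) (n : ℕ) : (𝒯.F n).Nonempty := by
  have h0 : (𝒯.F 0).Nonempty := Finset.card_pos.1 (by rw [h.card_F_zero]; exact one_pos)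
  have := mul_block_subset h (subset_refl (𝒯.F 0)) n
  rw [zero_add] at this
  exact (h0.mul (block_nonempty h 0 n)).mono this

/-- The product of the sets `C` is direct: multiplied on the left by any `f ∈ F n`, it takes place
inside the towers, where cancellation is available. -/
theorem card_block_succ (h : 𝒯.IsWeakCF) (n j : ℕ) :
    (𝒯.block n (j + 1)).card = (𝒯.block n j).card * (𝒯.C (n + j)).card := by
  rw [block, Finset.card_mul_iff]
  obtain ⟨f, hf⟩ := F_nonempty h n
  rintro ⟨b, c⟩ hb ⟨b', c'⟩ hb' e
  have key : ∀ b ∈ 𝒯.block n j, f * b ∈ 𝒯.F (n + j) := fun b hb =>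
    mul_block_subset h (Finset.singleton_subset_iff.2 hf) j
      (Finset.mul_mem_mul (Finset.mem_singleton_self f) hb)
  obtain ⟨h1, h2⟩ := h.cancel (key b hb.1) (key b' hb'.1) hb.2 hb'.2
    (by rw [mul_assoc, mul_assoc]; exact congrArg (f * ·) e)
  exact Prod.ext (mul_left_cancel h1) h2

theorem card_mul_block (h : 𝒯.IsWeakCF) {n : ℕ} {A : Finset G} (hA : A ⊆ 𝒯.F n) (j : ℕ) :
    (A * 𝒯.block n j).card = A.card * (𝒯.block n j).card := by
  induction j with
  | zero => simp [block, Finset.singleton_one]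
  | succ j ih =>
    rw [card_block_succ h, ← mul_assoc, ← ih, block, ← mul_assoc, Finset.card_mul_iff]
    rintro ⟨b, c⟩ hb ⟨b', c'⟩ hb' e
    obtain ⟨h1, h2⟩ := h.cancel (mul_block_subset h hA j hb.1) (mul_block_subset h hA j hb'.1)
      hb.2 hb'.2 e
    exact Prod.ext h1 h2

theorem levelMass_pos (h : 𝒯.IsWeakCF) (n : ℕ) : 0 < 𝒯.levelMass n :=
  inv_pos.2 (Finset.prod_pos fun i _ => Nat.cast_pos.2 (h.C_nonempty i).card_pos)

theorem levelMass_succ (h : 𝒯.IsWeakCF) (n : ℕ) :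
    (𝒯.C n).card * 𝒯.levelMass (n + 1) = 𝒯.levelMass n := by
  have : ((𝒯.C n).card : ℝ) ≠ 0 := Nat.cast_ne_zero.2 (h.C_nonempty n).card_pos.ne'
  rw [levelMass, levelMass, Finset.prod_range_succ, mul_inv]
  field_simp

theorem card_block_mul_levelMass (h : 𝒯.IsWeakCF) (n j : ℕ) :
    (𝒯.block n j).card * 𝒯.levelMass (n + j) = 𝒯.levelMass n := by
  induction j with
  | zero => simp [block, Finset.singleton_one]
  | succ j ih =>
    rw [card_block_succ h, ← ih, Nat.cast_mul, mul_assoc, ← add_assoc, levelMass_succ h]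

theorem card_mul_levelMass (h : 𝒯.IsWeakCF) {n m : ℕ} (hnm : n ≤ m) {A : Finset G}
    (hA : A ⊆ 𝒯.F n) :
    ((A * 𝒯.block n (m - n)).card : ℝ) * 𝒯.levelMass m = A.card * 𝒯.levelMass n := by
  obtain ⟨j, rfl⟩ := Nat.exists_eq_add_of_le hnm
  rw [Nat.add_sub_cancel_left, card_mul_block h hA, Nat.cast_mul, mul_assoc,
    card_block_mul_levelMass h]

/-! ### The ring of cylinders -/

theorem iUnion_cylinder_F (𝒯 : CFSeq G) : ⋃ n, 𝒯.cylinder n (𝒯.F n) = Set.univ := by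
  refine Set.eq_univ_of_forall fun x => Set.mem_iUnion.2 ?_
  obtain ⟨n, p, hp⟩ := exists_toSpace 𝒯 x
  exact ⟨n, p, p.1.2, hp⟩

theorem cylinder_mono {n : ℕ} {A B : Finset G} (hAB : A ⊆ B) :
    𝒯.cylinder n A ⊆ 𝒯.cylinder n B := by
  rintro x ⟨p, hp, hx⟩
  exact ⟨p, hAB hp, hx⟩

theorem monotone_cylinder_F (h : 𝒯.IsWeakCF) : Monotone fun n => 𝒯.cylinder n (𝒯.F n) := by
  refine monotone_nat_of_le_succ fun n => ?_
  rw [← cylinder_succ h (subset_refl (𝒯.F n))]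
  exact cylinder_mono (h.mul_subset n)

@[simp]
theorem cylinder_empty (n : ℕ) : 𝒯.cylinder n ∅ = ∅ := by
  ext x
  simp [cylinder]

theorem cylinder_inter (h : 𝒯.IsWeakCF) (n : ℕ) (A B : Finset G) :
    𝒯.cylinder n (A ∩ B) = 𝒯.cylinder n A ∩ 𝒯.cylinder n B := by
  refine (Set.subset_inter (cylinder_mono Finset.inter_subset_left)
    (cylinder_mono Finset.inter_subset_right)).antisymm ?_
  rintro x ⟨hA, hB⟩
  obtain ⟨u, hu, huA, hx⟩ := exists_path_of_mem_cylinder hA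
  exact (mem_cylinder_iff h hu hx le_rfl _).2
    (Finset.mem_inter.2 ⟨huA, (mem_cylinder_iff h hu hx le_rfl _).1 hB⟩)

theorem cylinder_union (n : ℕ) (A B : Finset G) :
    𝒯.cylinder n (A ∪ B) = 𝒯.cylinder n A ∪ 𝒯.cylinder n B := by
  ext x
  simp only [cylinder, Finset.mem_union, Set.mem_union, Set.mem_ofPred_eq, or_and_right, exists_or]

theorem cylinder_sdiff (h : 𝒯.IsWeakCF) (n : ℕ) (A B : Finset G) :
    𝒯.cylinder n (A \ B) = 𝒯.cylinder n A \ 𝒯.cylinder n B := by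
  ext x
  constructor
  · intro hx
    obtain ⟨u, hu, huA, hx⟩ := exists_path_of_mem_cylinder hx
    rw [Set.mem_sdiff, mem_cylinder_iff h hu hx le_rfl, mem_cylinder_iff h hu hx le_rfl]
    exact Finset.mem_sdiff.1 huA
  · rintro ⟨hA, hB⟩
    obtain ⟨u, hu, huA, hx⟩ := exists_path_of_mem_cylinder hA
    rw [mem_cylinder_iff h hu hx le_rfl] at hB ⊢
    exact Finset.mem_sdiff.2 ⟨huA, hB⟩

theorem cylinder_symmDiff (h : 𝒯.IsWeakCF) (n : ℕ) (A B : Finset G) :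
    𝒯.cylinder n (A ∆ B) = 𝒯.cylinder n A ∆ 𝒯.cylinder n B := by
  rw [symmDiff_def, symmDiff_def, Finset.sup_eq_union, cylinder_union, cylinder_sdiff h,
    cylinder_sdiff h]
  rfl

/-- Any two cylinders can be written as cylinders over subsets of one and the same tower. -/
theorem exists_common_level (h : 𝒯.IsWeakCF) (n m : ℕ) (A B : Finset G) :
    ∃ k A' B', A' ⊆ 𝒯.F k ∧ B' ⊆ 𝒯.F k ∧ 𝒯.cylinder n A = 𝒯.cylinder k A' ∧
      𝒯.cylinder m B = 𝒯.cylinder k B' := by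
  have hA : A ∩ 𝒯.F n ⊆ 𝒯.F n := Finset.inter_subset_right
  have hB : B ∩ 𝒯.F m ⊆ 𝒯.F m := Finset.inter_subset_right
  refine ⟨max n m, _, _, mul_block_subset' h (le_max_left n m) hA,
    mul_block_subset' h (le_max_right n m) hB, ?_, ?_⟩
  · rw [cylinder_of_le h (le_max_left n m) hA, cylinder_inter_F]
  · rw [cylinder_of_le h (le_max_right n m) hB, cylinder_inter_F]

/-- It serves twice: as a generating `π`-system for uniqueness of measures, and as a ring for the
approximation of measurable sets. -/
theorem isSetRing_cylinder (h : 𝒯.IsWeakCF) :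
    IsSetRing {s | ∃ (n : ℕ) (A : Finset G), s = 𝒯.cylinder n A} where
  empty_mem := ⟨0, ∅, by simp⟩
  union_mem := by
    rintro _ _ ⟨n, A, rfl⟩ ⟨m, B, rfl⟩
    obtain ⟨k, A', B', -, -, hA, hB⟩ := exists_common_level h n m A B
    exact ⟨k, A' ∪ B', by rw [hA, hB, cylinder_union]⟩
  sdiff_mem := by
    rintro _ _ ⟨n, A, rfl⟩ ⟨m, B, rfl⟩
    obtain ⟨k, A', B', -, -, hA, hB⟩ := exists_common_level h n m A B
    exact ⟨k, A' \ B', by rw [hA, hB, cylinder_sdiff h]⟩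

theorem measurableSet_cylinder (n : ℕ) (A : Finset G) : MeasurableSet (𝒯.cylinder n A) :=
  MeasurableSpace.measurableSet_generateFrom ⟨n, A, rfl⟩

/-! ### Partial maps -/

/-- The action and all elementary maps are partial maps of this kind, so each membership statement
becomes an equation between germs. -/
theorem mem_partialMap {Φ : Germ (atTop : Filter ℕ) G → Germ (atTop : Filter ℕ) G} {x : 𝒯.Space}
    {y : 𝒯'.Space} : y ∈ partialMap 𝒯 𝒯' Φ x ↔ y.1 = Φ x.1 := by
  constructor
  · rintro ⟨h, rfl⟩
    rfl
  · intro e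
    obtain ⟨n, p, hp⟩ := y.2
    exact ⟨⟨n, p, hp.trans e⟩, Subtype.ext e.symm⟩

theorem mem_partialInverse {α β : Type*} {f : α →. β} {a : α} {b : β} :
    a ∈ partialInverse f b ↔ b ∈ f a ∧ ∀ a', b ∈ f a' → a' = a := by
  constructor
  · rintro ⟨h, rfl⟩
    exact h.choose_spec
  · rintro ⟨h1, h2⟩
    have h : ∃! a, b ∈ f a := ⟨a, h1, h2⟩
    exact ⟨h, h2 _ h.choose_spec.1⟩

/-! ### The Haar measure of cylinders -/

section HaarCylinder

attribute [local instance] finsetMeasurableSpace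

theorem toSpace_mem_cylinder_iff (h : 𝒯.IsWeakCF) {n : ℕ} (p : 𝒯.Level n) (j : ℕ) (A : Finset G) :
    𝒯.toSpace n p ∈ 𝒯.cylinder (n + j) A ↔
      partialProd (p.1 : G) (fun j => (p.2 j : G)) j ∈ A := by
  rw [mem_cylinder_iff h (isPath_partialProd p) rfl (Nat.le_add_right n j),
    Nat.add_sub_cancel_left]

/-- Cancellation recovers from `f` all factors of the partial product. The preimage is thus a box in
finitely many coordinates, whose product measure can be computed. -/
theorem preimage_toSpace_cylinder_singleton (h : 𝒯.IsWeakCF) {n j : ℕ} {f : G} {p : 𝒯.Level n}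
    (hp : 𝒯.toSpace n p ∈ 𝒯.cylinder (n + j) {f}) :
    𝒯.toSpace n ⁻¹' 𝒯.cylinder (n + j) {f} =
      {p.1} ×ˢ Set.pi (Finset.range j) fun i => {p.2 i} := by
  rw [toSpace_mem_cylinder_iff h, Finset.mem_singleton] at hp
  ext q
  rw [Set.mem_preimage, toSpace_mem_cylinder_iff h, Finset.mem_singleton, ← hp]
  simp only [Set.mem_prod, Set.mem_singleton_iff, Set.mem_pi, Finset.coe_range, Set.mem_Iio]
  clear hp
  induction j with
  | zero =>
    exact ⟨fun e => ⟨Subtype.ext e, fun i hi => absurd hi (Nat.not_lt_zero i)⟩,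
      fun e => congrArg Subtype.val e.1⟩
  | succ j ih =>
    rw [partialProd, partialProd]
    constructor
    · intro e
      obtain ⟨h1, h2⟩ := h.cancel (partialProd_mem h q j) (partialProd_mem h p j) (q.2 j).2
        (p.2 j).2 e
      obtain ⟨h3, h4⟩ := ih.1 h1
      refine ⟨h3, fun i hi => ?_⟩
      rcases Nat.lt_succ_iff_lt_or_eq.1 hi with hi | rfl
      · exact h4 i hi
      · exact Subtype.ext h2
    · rintro ⟨h1, h2⟩
      rw [ih.2 ⟨h1, fun i hi => h2 i (by omega)⟩, h2 j (by omega)]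

theorem measurableSet_preimage_toSpace (h : 𝒯.IsWeakCF) (n j : ℕ) (f : G) :
    MeasurableSet (𝒯.toSpace n ⁻¹' 𝒯.cylinder (n + j) {f}) := by
  rcases (𝒯.toSpace n ⁻¹' 𝒯.cylinder (n + j) {f}).eq_empty_or_nonempty with he | ⟨p, hp⟩
  · rw [he]
    exact MeasurableSet.empty
  · rw [preimage_toSpace_cylinder_singleton h hp]
    refine MeasurableSet.prod trivial (MeasurableSet.pi (Finset.countable_toSet _) fun i _ => ?_)
    exact trivial

theorem cylinder_eq_biUnion (n : ℕ) (A : Finset G) :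
    𝒯.cylinder n A = ⋃ f ∈ A, 𝒯.cylinder n {f} := by
  ext x
  simp only [cylinder, Finset.mem_singleton, Set.mem_iUnion, Set.mem_ofPred_eq]
  constructor
  · rintro ⟨p, hp, hx⟩
    exact ⟨_, hp, p, rfl, hx⟩
  · rintro ⟨f, hf, p, rfl, hx⟩
    exact ⟨p, hf, hx⟩

theorem measurable_toSpace (h : 𝒯.IsWeakCF) (n : ℕ) : Measurable (𝒯.toSpace n) := by
  refine measurable_generateFrom ?_
  rintro _ ⟨m, A, rfl⟩
  have key : ∀ j B, MeasurableSet (𝒯.toSpace n ⁻¹' 𝒯.cylinder (n + j) B) := by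
    intro j B
    rw [cylinder_eq_biUnion, Set.preimage_iUnion₂]
    exact Finset.measurableSet_biUnion B fun f _ => measurableSet_preimage_toSpace h n j f
  rw [← cylinder_inter_F, ← cylinder_of_le h (le_max_right n m) Finset.inter_subset_right]
  obtain ⟨j, hj⟩ := Nat.exists_eq_add_of_le (le_max_left n m)
  rw [hj]
  exact key j _

theorem levelMeasure_preimage (h : 𝒯.IsWeakCF) [∀ n, Nonempty (𝒯.C n)] {n j : ℕ} {f : G}
    {p : 𝒯.Level n} (hp : 𝒯.toSpace n p ∈ 𝒯.cylinder (n + j) {f}) :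
    𝒯.levelMeasure n (𝒯.toSpace n ⁻¹' 𝒯.cylinder (n + j) {f}) =
      ENNReal.ofReal (𝒯.levelMass (n + j)) := by
  rw [preimage_toSpace_cylinder_singleton h hp, levelMeasure, Measure.prod_prod,
    Measure.infinitePi_pi _ fun i _ => MeasurableSpace.measurableSet_top, Measure.smul_apply,
    Measure.count_singleton]
  have h1 : ∀ i, (PMF.uniformOfFintype (𝒯.C (n + i))).toMeasure {p.2 i} =
      ENNReal.ofReal ((𝒯.C (n + i)).card : ℝ)⁻¹ := by
    intro i
    rw [PMF.toMeasure_apply_singleton _ _ MeasurableSpace.measurableSet_top, PMF.uniformOfFintype_apply, Fintype.card_coe,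
      ENNReal.ofReal_inv_of_pos (Nat.cast_pos.2 (h.C_nonempty _).card_pos), ENNReal.ofReal_natCast]
  simp only [h1, smul_eq_mul, mul_one]
  rw [← ENNReal.ofReal_prod_of_nonneg fun i _ => by positivity,
    ← ENNReal.ofReal_mul (levelMass_pos h n).le]
  congr 1
  rw [levelMass, levelMass, Finset.prod_range_add, mul_inv, Finset.prod_inv_distrib]

theorem range_toSpace (n : ℕ) : Set.range (𝒯.toSpace n) = 𝒯.cylinder n (𝒯.F n) := by
  ext x
  exact ⟨fun ⟨p, hp⟩ => ⟨p, p.1.2, hp⟩, fun ⟨p, _, hp⟩ => ⟨p, hp⟩⟩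

theorem cylinder_nonempty (h : 𝒯.IsWeakCF) {n : ℕ} {f : G} (hf : f ∈ 𝒯.F n) :
    (𝒯.cylinder n {f}).Nonempty :=
  ⟨_, (⟨f, hf⟩, fun j => ⟨_, (h.C_nonempty (n + j)).choose_spec⟩), Finset.mem_singleton_self f, rfl⟩

/-- For `n ≤ N` the set `X_n` is itself a cylinder of level `N`, so it contains `[f]_N` or misses
it. Hence `[f]_N` lies in one piece of the partition that defines `haar`, that of the first `X_n` it
meets, and only one summand survives. -/
theorem haar_cylinder_singleton (h : 𝒯.IsWeakCF) {N : ℕ} {f : G} (hf : f ∈ 𝒯.F N) :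
    𝒯.haar (𝒯.cylinder N {f}) = ENNReal.ofReal (𝒯.levelMass N) := by
  have : ∀ n, Nonempty (𝒯.C n) := fun n => (h.C_nonempty n).to_subtype
  have hm : MeasurableSet (𝒯.cylinder N {f}) := measurableSet_cylinder N {f}
  rw [haar, dif_pos h.C_nonempty, Measure.sum_apply _ hm]
  have hex : ∃ n, (𝒯.cylinder N {f} ∩ Set.range (𝒯.toSpace n)).Nonempty := by
    refine ⟨N, ?_⟩
    rw [range_toSpace, ← cylinder_inter h,
      Finset.inter_eq_left.2 (Finset.singleton_subset_iff.2 hf)]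
    exact cylinder_nonempty h hf
  classical
  obtain ⟨n, hn, hmin⟩ : ∃ n, (𝒯.cylinder N {f} ∩ Set.range (𝒯.toSpace n)).Nonempty ∧
      ∀ m < n, ¬(𝒯.cylinder N {f} ∩ Set.range (𝒯.toSpace m)).Nonempty :=
    ⟨Nat.find hex, Nat.find_spec hex, fun m => Nat.find_min hex⟩
  have hnN : n ≤ N := by
    by_contra hlt
    refine hmin N (not_le.1 hlt) ?_
    rw [range_toSpace, ← cylinder_inter h,
      Finset.inter_eq_left.2 (Finset.singleton_subset_iff.2 hf)]
    exact cylinder_nonempty h hf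
  have hsub : 𝒯.cylinder N {f} ⊆ Set.range (𝒯.toSpace n) := by
    rw [range_toSpace, ← cylinder_of_le h hnN subset_rfl]
    refine cylinder_mono (Finset.singleton_subset_iff.2 ?_)
    rw [range_toSpace, ← cylinder_of_le h hnN subset_rfl, ← cylinder_inter h] at hn
    by_contra hnot
    rw [Finset.singleton_inter_of_notMem hnot, cylinder_empty] at hn
    exact Set.not_nonempty_empty hn
  have hdis : 𝒯.cylinder N {f} ⊆ disjointed (fun m => Set.range (𝒯.toSpace m)) n := by
    rw [disjointed_eq_inter_compl]
    refine Set.subset_inter hsub (Set.subset_iInter₂ fun m hmn x hx hxm => ?_)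
    exact hmin m hmn ⟨x, hx, hxm⟩
  rw [tsum_eq_single n]
  · rw [Measure.restrict_apply hm, Set.inter_eq_left.2 hdis,
      Measure.map_apply (measurable_toSpace h n) hm]
    obtain ⟨j, rfl⟩ := Nat.exists_eq_add_of_le hnN
    obtain ⟨_, hx, p, rfl⟩ := hn
    exact levelMeasure_preimage h hx
  · intro m hmn
    rw [Measure.restrict_apply hm]
    have := (disjoint_disjointed fun m => Set.range (𝒯.toSpace m)) hmn
    rw [((this.mono_right hdis).symm).inter_eq, measure_empty]

end HaarCylinder

theorem disjoint_cylinder (h : 𝒯.IsWeakCF) (n : ℕ) {A B : Finset G} (hAB : Disjoint A B) :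
    Disjoint (𝒯.cylinder n A) (𝒯.cylinder n B) := by
  rw [Set.disjoint_iff_inter_eq_empty, ← cylinder_inter h, Finset.disjoint_iff_inter_eq_empty.1 hAB,
    cylinder_empty]

theorem measure_cylinder (h : 𝒯.IsWeakCF) (ν : Measure 𝒯.Space) (n : ℕ) (A : Finset G) :
    ν (𝒯.cylinder n A) = ∑ f ∈ A, ν (𝒯.cylinder n {f}) := by
  rw [cylinder_eq_biUnion, measure_biUnion_finset]
  · exact fun f _ f' _ hff => disjoint_cylinder h n (Finset.disjoint_singleton.2 hff)
  · exact fun f _ => measurableSet_cylinder n {f}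

theorem haar_cylinder (h : 𝒯.IsWeakCF) {n : ℕ} {A : Finset G} (hA : A ⊆ 𝒯.F n) :
    𝒯.haar (𝒯.cylinder n A) = ENNReal.ofReal (A.card * 𝒯.levelMass n) := by
  rw [measure_cylinder h, Finset.sum_congr rfl fun f hf => haar_cylinder_singleton h (hA hf),
    Finset.sum_const, nsmul_eq_mul, ENNReal.ofReal_mul (Nat.cast_nonneg _), ENNReal.ofReal_natCast]

theorem haar_cylinder_ne_top (h : 𝒯.IsWeakCF) (n : ℕ) (A : Finset G) :
    𝒯.haar (𝒯.cylinder n A) ≠ ⊤ := by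
  rw [← cylinder_inter_F, haar_cylinder h Finset.inter_subset_right]
  exact ENNReal.ofReal_ne_top

/-- Two measures that agree on the cylinders, where they are finite, are equal. -/
theorem measure_ext (h : 𝒯.IsWeakCF) {ν ν' : Measure 𝒯.Space}
    (hfin : ∀ n, ν (𝒯.cylinder n (𝒯.F n)) ≠ ⊤)
    (heq : ∀ n, ∀ f ∈ 𝒯.F n, ν (𝒯.cylinder n {f}) = ν' (𝒯.cylinder n {f})) : ν = ν' := by
  refine Measure.ext_of_generateFrom_of_iUnion _ (fun n => 𝒯.cylinder n (𝒯.F n)) rfl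
    (isSetRing_cylinder h).isSetSemiring.isPiSystem 𝒯.iUnion_cylinder_F (fun n => ⟨n, _, rfl⟩)
    hfin ?_
  rintro _ ⟨n, A, rfl⟩
  rw [← cylinder_inter_F, measure_cylinder h, measure_cylinder h ν']
  exact Finset.sum_congr rfl fun f hf => heq n f (Finset.mem_inter.1 hf).2

theorem sigmaFinite_of_cylinder {ν : Measure 𝒯.Space}
    (hfin : ∀ n, ν (𝒯.cylinder n (𝒯.F n)) ≠ ⊤) : SigmaFinite ν :=
  ⟨⟨{ set := fun n => 𝒯.cylinder n (𝒯.F n)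
      set_mem := fun _ => trivial
      finite := fun n => (hfin n).lt_top
      spanning := 𝒯.iUnion_cylinder_F }⟩⟩

theorem sigmaFinite_haar (h : 𝒯.IsWeakCF) : SigmaFinite 𝒯.haar :=
  sigmaFinite_of_cylinder fun n => haar_cylinder_ne_top h n _

/-- Sets of finite measure are approximated by cylinders. -/
theorem exists_cylinder_symmDiff_lt (h : 𝒯.IsWeakCF) {s : Set 𝒯.Space} (hs : MeasurableSet s)
    (hfin : 𝒯.haar s ≠ ⊤) {δ : ENNReal} (hδ : 0 < δ) :
    ∃ n, ∃ A ⊆ 𝒯.F n, 𝒯.haar (s ∆ 𝒯.cylinder n A) < δ := by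
  have hδ2 : 0 < δ / 2 := ENNReal.half_pos hδ.ne'
  have hlim : Tendsto (fun n => 𝒯.haar (s \ 𝒯.cylinder n (𝒯.F n))) atTop (nhds 0) := by
    have := tendsto_measure_iInter_atTop (μ := 𝒯.haar)
      (s := fun n => s \ 𝒯.cylinder n (𝒯.F n))
      (fun n => (hs.diff (measurableSet_cylinder n _)).nullMeasurableSet)
      (fun n m hnm => Set.sdiff_subset_sdiff_right (monotone_cylinder_F h hnm))
      ⟨0, ne_top_of_le_ne_top hfin (measure_mono Set.sdiff_subset)⟩
    rwa [← Set.sdiff_iUnion, iUnion_cylinder_F, Set.sdiff_univ, measure_empty] at this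
  obtain ⟨N, hN⟩ := (hlim.eventually (gt_mem_nhds hδ2)).exists
  -- Approximation by a generating ring is applied to a finite measure, so all but a small part of
  -- `s` is first confined to `X_N`.
  have : IsFiniteMeasure (𝒯.haar.restrict (𝒯.cylinder N (𝒯.F N))) :=
    ⟨by rw [Measure.restrict_apply_univ]; exact (haar_cylinder_ne_top h N _).lt_top⟩
  obtain ⟨_, ⟨n, A, rfl⟩, hA⟩ := exists_measure_symmDiff_lt_of_generateFrom_isSetRing
    (μ := 𝒯.haar.restrict (𝒯.cylinder N (𝒯.F N))) (isSetRing_cylinder h)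
    ⟨Set.range fun n => 𝒯.cylinder n (𝒯.F n), Set.countable_range _,
      by rintro _ ⟨n, rfl⟩; exact ⟨n, _, rfl⟩,
      by rw [Set.sUnion_range, iUnion_cylinder_F, Set.compl_univ, measure_empty]⟩ rfl hs hδ2
  obtain ⟨k, A', B', hA', -, hAA, hBB⟩ := exists_common_level h n N A (𝒯.F N)
  -- The ring element is controlled only inside `X_N`, which at level `k` is the cylinder over `B'`;
  -- it is therefore cut down to it.
  refine ⟨k, A' ∩ B', Finset.inter_subset_left.trans hA', ?_⟩
  rw [Measure.restrict_apply
    (((measurableSet_cylinder n A).symmDiff hs)), hAA, hBB] at hA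
  rw [hBB] at hN
  rw [cylinder_inter h]
  calc 𝒯.haar (s ∆ (𝒯.cylinder k A' ∩ 𝒯.cylinder k B'))
      ≤ 𝒯.haar ((𝒯.cylinder k A' ∆ s) ∩ 𝒯.cylinder k B' ∪ s \ 𝒯.cylinder k B') := by
        refine measure_mono fun x hx => ?_
        simp only [Set.mem_symmDiff, Set.mem_inter_iff, Set.mem_union, Set.mem_sdiff] at hx ⊢
        tauto
    _ ≤ _ := measure_union_le _ _
    _ < δ / 2 + δ / 2 := ENNReal.add_lt_add hA hN
    _ = δ := ENNReal.add_halves δ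

/-! ### The action -/

theorem mem_act {g : G} {x y : 𝒯.Space} :
    y ∈ 𝒯.act g x ↔ y.1 = Germ.map (fun s => g * s) x.1 :=
  mem_partialMap

theorem mem_act_iff {g : G} {x y : 𝒯.Space} {u : ℕ → G}
    (hx : x.1 = (u : Germ (atTop : Filter ℕ) G)) :
    y ∈ 𝒯.act g x ↔ y.1 = ((fun n => g * u n : ℕ → G) : Germ (atTop : Filter ℕ) G) := by
  rw [mem_act, hx]
  rfl

theorem mem_act_mul {g g' : G} {x y z : 𝒯.Space} (hy : y ∈ 𝒯.act g x) (hz : z ∈ 𝒯.act g' y) :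
    z ∈ 𝒯.act (g' * g) x := by
  obtain ⟨N, u, -, hx⟩ := exists_path x
  rw [mem_act_iff hx] at hy ⊢
  rw [mem_act_iff hy] at hz
  simpa only [mul_assoc] using hz

theorem mem_act_one {x y : 𝒯.Space} : y ∈ 𝒯.act 1 x ↔ y = x := by
  obtain ⟨N, u, -, hx⟩ := exists_path x
  rw [mem_act_iff hx]
  simp only [one_mul, ← hx]
  exact Subtype.ext_iff.symm

theorem mem_act_inv {g : G} {x y : 𝒯.Space} (hy : y ∈ 𝒯.act g x) : x ∈ 𝒯.act g⁻¹ y := by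
  obtain ⟨N, u, -, hx⟩ := exists_path x
  rw [mem_act_iff hx] at hy
  rw [mem_act_iff hy, hx]
  simp only [inv_mul_cancel_left]

theorem act_unique {g : G} {x y z : 𝒯.Space} (hy : y ∈ 𝒯.act g x) (hz : z ∈ 𝒯.act g x) :
    y = z :=
  Part.mem_unique hy hz

/-- Left multiplication leaves the steps `(u m)⁻¹ * u (m + 1)` unchanged, so only the starting level
has to be checked. -/
theorem IsPath.smul {u : ℕ → G} {n : ℕ} (hu : 𝒯.IsPath u n) {g : G} (hg : g * u n ∈ 𝒯.F n) :
    𝒯.IsPath (fun m => g * u m) n :=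
  ⟨hg, fun m hm => by
    rw [mul_inv_rev, mul_assoc, inv_mul_cancel_left]
    exact hu.step m hm⟩

theorem exists_mem_act {g : G} {n : ℕ} {A : Finset G} (hA : ∀ f ∈ A, g * f ∈ 𝒯.F n)
    {x : 𝒯.Space} (hx : x ∈ 𝒯.cylinder n A) : ∃ y, y ∈ 𝒯.act g x := by
  obtain ⟨u, hu, huA, hxu⟩ := exists_path_of_mem_cylinder hx
  exact ⟨(hu.smul (hA _ huA)).point, (mem_act_iff hxu).2 rfl⟩

theorem mem_cylinder_of_mem_act (h : 𝒯.IsWeakCF) {g : G} {n : ℕ} {A B : Finset G}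
    (hA : ∀ f ∈ A, g * f ∈ B ∩ 𝒯.F n) {x y : 𝒯.Space} (hy : y ∈ 𝒯.act g x)
    (hx : x ∈ 𝒯.cylinder n A) : y ∈ 𝒯.cylinder n B := by
  obtain ⟨u, hu, huA, hxu⟩ := exists_path_of_mem_cylinder hx
  have := Finset.mem_inter.1 (hA _ huA)
  exact (mem_cylinder_iff h (hu.smul this.2) ((mem_act_iff hxu).1 hy) le_rfl B).2 this.1

theorem mem_cylinder_smul_iff (h : 𝒯.IsWeakCF) {g : G} {n : ℕ} {A : Finset G}
    (hA : A ⊆ 𝒯.F n) (hgA : g • A ⊆ 𝒯.F n) {x y : 𝒯.Space} (hy : y ∈ 𝒯.act g x) :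
    y ∈ 𝒯.cylinder n (g • A) ↔ x ∈ 𝒯.cylinder n A := by
  constructor
  · refine mem_cylinder_of_mem_act h (fun f hf => ?_) (mem_act_inv hy)
    obtain ⟨a, ha, rfl⟩ := Finset.mem_smul_finset.1 hf
    rw [smul_eq_mul, inv_mul_cancel_left]
    exact Finset.mem_inter.2 ⟨ha, hA ha⟩
  · refine mem_cylinder_of_mem_act h (fun f hf => ?_) hy
    have := Finset.smul_mem_smul_finset (a := g) hf
    exact Finset.mem_inter.2 ⟨this, hgA this⟩

open Classical in
/-- The transformation `T_g`, extended by the identity to the whole space. -/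
noncomputable def actFun (𝒯 : CFSeq G) (g : G) (x : 𝒯.Space) : 𝒯.Space :=
  if h : (𝒯.act g x).Dom then (𝒯.act g x).get h else x

theorem actFun_mem {g : G} {x : 𝒯.Space} (h : (𝒯.act g x).Dom) : 𝒯.actFun g x ∈ 𝒯.act g x := by
  rw [actFun, dif_pos h]
  exact Part.get_mem h

/-- The limit condition passes from `F n` to a subset `A`: what `g` pushes out of the tower over `A`
is part of what it pushes out over `F n`, and the mass of the latter tends to `0`. -/
theorem tendsto_card_inter (h : 𝒯.IsWeakCF) (hact : 𝒯.IsMeasurePreserving) (g : G) {n : ℕ}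
    {A : Finset G} (hA : A ⊆ 𝒯.F n) :
    Tendsto (fun j => (((g • (A * 𝒯.block n j)) ∩ 𝒯.F (n + j)).card : ℝ) * 𝒯.levelMass (n + j))
      atTop (nhds (A.card * 𝒯.levelMass n)) := by
  have hF : Tendsto (fun j => (((g • (𝒯.F n * 𝒯.block n j)) ∩ 𝒯.F (n + j)).card : ℝ) *
      𝒯.levelMass (n + j)) atTop (nhds ((𝒯.F n).card * 𝒯.levelMass n)) := by
    have := (hact g n).comp (tendsto_add_atTop_nat n)
    refine this.congr fun j => ?_
    simp only [Function.comp_apply, Nat.add_comm j n, Nat.add_sub_cancel_left]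
  have hcard : ∀ B ⊆ 𝒯.F n, ∀ j, ((g • (B * 𝒯.block n j)).card : ℝ) * 𝒯.levelMass (n + j) =
      B.card * 𝒯.levelMass n := by
    intro B hB j
    rw [Finset.card_smul_finset, card_mul_block h hB, Nat.cast_mul, mul_assoc,
      card_block_mul_levelMass h]
  have hsplit : ∀ (B : Finset G) j, ((g • (B * 𝒯.block n j)).card : ℝ) =
      ((g • (B * 𝒯.block n j)) ∩ 𝒯.F (n + j)).card +
        ((g • (B * 𝒯.block n j)) \ 𝒯.F (n + j)).card := by
    intro B j
    exact_mod_cast (Finset.card_inter_add_card_sdiff _ _).symm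
  have hlow : Tendsto (fun j => (A.card * 𝒯.levelMass n) - ((𝒯.F n).card * 𝒯.levelMass n -
      (((g • (𝒯.F n * 𝒯.block n j)) ∩ 𝒯.F (n + j)).card : ℝ) * 𝒯.levelMass (n + j)))
      atTop (nhds (A.card * 𝒯.levelMass n)) := by
    have := (tendsto_const_nhds (x := (A.card * 𝒯.levelMass n))).sub
      ((tendsto_const_nhds (x := ((𝒯.F n).card * 𝒯.levelMass n))).sub hF)
    simpa using this
  refine tendsto_of_tendsto_of_tendsto_of_le_of_le hlow tendsto_const_nhds (fun j => ?_)
    fun j => ?_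
  · have h1 := hcard A hA j
    have h2 := hcard _ subset_rfl j
    rw [hsplit] at h1 h2
    have h3 : ((g • (A * 𝒯.block n j)) \ 𝒯.F (n + j)).card ≤
        ((g • (𝒯.F n * 𝒯.block n j)) \ 𝒯.F (n + j)).card :=
      Finset.card_le_card (Finset.sdiff_subset_sdiff
        (Finset.smul_finset_subset_smul_finset (Finset.mul_subset_mul_right hA)) subset_rfl)
    have h4 : (((g • (A * 𝒯.block n j)) \ 𝒯.F (n + j)).card : ℝ) * 𝒯.levelMass (n + j) ≤
        ((g • (𝒯.F n * 𝒯.block n j)) \ 𝒯.F (n + j)).card * 𝒯.levelMass (n + j) :=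
      mul_le_mul_of_nonneg_right (Nat.cast_le.2 h3) (levelMass_pos h _).le
    simp only
    linarith
  · have h1 := hcard A hA j
    rw [hsplit] at h1
    have : 0 ≤ (((g • (A * 𝒯.block n j)) \ 𝒯.F (n + j)).card : ℝ) * 𝒯.levelMass (n + j) :=
      mul_nonneg (Nat.cast_nonneg _) (levelMass_pos h _).le
    simp only
    linarith

/-- The part of the tower `F_{n+j}` that `g` moves into the subtower over `A ⊆ F_n`. -/
def pull (𝒯 : CFSeq G) (g : G) (n : ℕ) (A : Finset G) (j : ℕ) : Finset G :=
  (𝒯.F (n + j)).filter fun s => g * s ∈ A * 𝒯.block n j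

theorem mem_pull {g s : G} {n j : ℕ} {A : Finset G} :
    s ∈ 𝒯.pull g n A j ↔ s ∈ 𝒯.F (n + j) ∧ g * s ∈ A * 𝒯.block n j :=
  Finset.mem_filter

theorem pull_eq (g : G) (n : ℕ) (A : Finset G) (j : ℕ) :
    𝒯.pull g n A j = (g⁻¹ • (A * 𝒯.block n j)) ∩ 𝒯.F (n + j) := by
  ext s
  rw [mem_pull, Finset.mem_inter, Finset.mem_inv_smul_finset_iff, smul_eq_mul, and_comm]

/-- The part of the subtower of `F_{n+j}` over `A ⊆ F_n` that `g` moves into `F_{n+j}`. -/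
def keep (𝒯 : CFSeq G) (g : G) (n : ℕ) (A : Finset G) (j : ℕ) : Finset G :=
  (A * 𝒯.block n j).filter fun s => g * s ∈ 𝒯.F (n + j)

theorem mem_keep {g s : G} {n j : ℕ} {A : Finset G} :
    s ∈ 𝒯.keep g n A j ↔ s ∈ A * 𝒯.block n j ∧ g * s ∈ 𝒯.F (n + j) :=
  Finset.mem_filter

theorem card_keep (g : G) (n : ℕ) (A : Finset G) (j : ℕ) :
    (𝒯.keep g n A j).card = ((g • (A * 𝒯.block n j)) ∩ 𝒯.F (n + j)).card := by
  rw [← Finset.card_smul_finset g (𝒯.keep g n A j)]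
  congr 1
  ext s
  rw [← Finset.inv_smul_mem_iff, mem_keep, Finset.mem_inter, ← Finset.inv_smul_mem_iff, smul_eq_mul,
    mul_inv_cancel_left]

theorem keep_subset (h : 𝒯.IsWeakCF) (g : G) {n : ℕ} {A : Finset G} (hA : A ⊆ 𝒯.F n) (j : ℕ) :
    𝒯.keep g n A j ⊆ 𝒯.F (n + j) :=
  (Finset.filter_subset _ _).trans (mul_block_subset h hA j)

theorem tendsto_haar_keep (h : 𝒯.IsWeakCF) (hact : 𝒯.IsMeasurePreserving) (g : G) {n : ℕ}
    {A : Finset G} (hA : A ⊆ 𝒯.F n) :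
    Tendsto (fun j => 𝒯.haar (𝒯.cylinder (n + j) (𝒯.keep g n A j))) atTop
      (nhds (𝒯.haar (𝒯.cylinder n A))) := by
  simp only [haar_cylinder h hA, haar_cylinder h (keep_subset h g hA _), card_keep]
  exact (ENNReal.continuous_ofReal.tendsto _).comp (tendsto_card_inter h hact g hA)

theorem tendsto_haar_sdiff_keep (h : 𝒯.IsWeakCF) (hact : 𝒯.IsMeasurePreserving) (g : G) {n : ℕ}
    {A : Finset G} (hA : A ⊆ 𝒯.F n) :
    Tendsto (fun j => 𝒯.haar (𝒯.cylinder n A \ 𝒯.cylinder (n + j) (𝒯.keep g n A j))) atTop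
      (nhds 0) := by
  have h1 : ∀ j, 𝒯.haar (𝒯.cylinder n A \ 𝒯.cylinder (n + j) (𝒯.keep g n A j)) =
      𝒯.haar (𝒯.cylinder n A) - 𝒯.haar (𝒯.cylinder (n + j) (𝒯.keep g n A j)) := by
    intro j
    refine measure_sdiff ?_ (measurableSet_cylinder _ _).nullMeasurableSet
      (haar_cylinder_ne_top h _ _)
    rw [← cylinder_add h hA j]
    exact cylinder_mono (Finset.filter_subset _ _)
  simp only [h1]
  have := ENNReal.Tendsto.sub (tendsto_const_nhds (x := 𝒯.haar (𝒯.cylinder n A)))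
    (tendsto_haar_keep h hact g hA) (Or.inl (haar_cylinder_ne_top h n A))
  rwa [tsub_self] at this

theorem ae_of_forall_cylinder {ν : Measure 𝒯.Space} {p : 𝒯.Space → Prop}
    (hp : ∀ n, ν (𝒯.cylinder n (𝒯.F n) ∩ {x | ¬p x}) = 0) : ∀ᵐ x ∂ν, p x := by
  rw [ae_iff, ← Set.univ_inter {x | ¬p x}, ← iUnion_cylinder_F, Set.iUnion_inter]
  exact measure_iUnion_null hp

/-- Every `T_g` is defined almost everywhere. -/
theorem ae_act_dom (h : 𝒯.IsWeakCF) (hact : 𝒯.IsMeasurePreserving) (g : G) :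
    ∀ᵐ x ∂𝒯.haar, (𝒯.act g x).Dom := by
  refine ae_of_forall_cylinder fun n => le_antisymm ?_ zero_le
  -- `T_g` is defined on the kept part, so for every `j` the bad points of `X_n` lie in the
  -- complement of that part, whose measure tends to `0`.
  refine ge_of_tendsto' (tendsto_haar_sdiff_keep h hact g (subset_refl (𝒯.F n))) fun j => ?_
  refine measure_mono fun x hx => ⟨hx.1, fun hk => hx.2 ?_⟩
  obtain ⟨y, hy⟩ := exists_mem_act (g := g) (fun f hf => (mem_keep.1 hf).2) hk
  exact Part.dom_iff_mem.2 ⟨y, hy⟩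

theorem ae_actFun_mem (h : 𝒯.IsWeakCF) (hact : 𝒯.IsMeasurePreserving) (g : G) :
    ∀ᵐ x ∂𝒯.haar, 𝒯.actFun g x ∈ 𝒯.act g x := by
  filter_upwards [ae_act_dom h hact g] with x hx using actFun_mem hx

/-- Equality of germs is decided at some finite level, where it is a condition on one coordinate.
The preimage is thus a countable union of cylinders, in particular measurable. -/
theorem act_preimage_cylinder (h : 𝒯.IsWeakCF) (g : G) {n : ℕ} {A : Finset G} (hA : A ⊆ 𝒯.F n) :
    {x | ∃ y ∈ 𝒯.act g x, y ∈ 𝒯.cylinder n A} = ⋃ j, 𝒯.cylinder (n + j) (𝒯.pull g n A j) := by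
  ext x
  rw [Set.mem_iUnion]
  constructor
  · rintro ⟨y, hy, hyA⟩
    obtain ⟨u, hu, huA, hyu⟩ := exists_path_of_mem_cylinder hyA
    obtain ⟨N, v, hv, hxv⟩ := exists_path x
    have hN : ∀ᶠ m in atTop, u m = g * v m :=
      Germ.coe_eq.1 (hyu.symm.trans ((mem_act_iff hxv).1 hy))
    obtain ⟨m, hm, hNm, hnm⟩ :=
      (hN.and ((eventually_ge_atTop N).and (eventually_ge_atTop n))).exists
    obtain ⟨j, rfl⟩ := Nat.exists_eq_add_of_le hnm
    refine ⟨j, (mem_cylinder_iff h hv hxv hNm _).2 (mem_pull.2 ⟨hv.mem_F h hNm, ?_⟩)⟩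
    rw [← hm, ← mul_inv_cancel_left (u n) (u (n + j))]
    exact Finset.mul_mem_mul huA (hu.mem_block le_rfl j)
  · rintro ⟨j, hj⟩
    have hF : ∀ f ∈ 𝒯.pull g n A j, g * f ∈ 𝒯.F (n + j) := fun f hf =>
      mul_block_subset h hA j (mem_pull.1 hf).2
    obtain ⟨y, hy⟩ := exists_mem_act hF hj
    refine ⟨y, hy, ?_⟩
    rw [← cylinder_add h hA j]
    exact mem_cylinder_of_mem_act h
      (fun f hf => Finset.mem_inter.2 ⟨(mem_pull.1 hf).2, hF f hf⟩) hy hj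

theorem monotone_cylinder_pull (h : 𝒯.IsWeakCF) (g : G) (n : ℕ) (A : Finset G) :
    Monotone fun j => 𝒯.cylinder (n + j) (𝒯.pull g n A j) := by
  refine monotone_nat_of_le_succ fun j x hx => ?_
  obtain ⟨u, hu, huA, hxu⟩ := exists_path_of_mem_cylinder hx
  refine (mem_cylinder_iff h hu hxu (by omega) _).2
    (mem_pull.2 ⟨hu.mem_F h (by omega), ?_⟩)
  have := Finset.mul_mem_mul (mem_pull.1 huA).2 (hu.step (n + j) le_rfl)
  rw [mul_assoc g, mul_inv_cancel_left] at this
  rwa [block, ← mul_assoc]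

theorem measurableSet_act_preimage_cylinder (h : 𝒯.IsWeakCF) (g : G) (n : ℕ) (A : Finset G) :
    MeasurableSet {x | ∃ y ∈ 𝒯.act g x, y ∈ 𝒯.cylinder n A} := by
  rw [← cylinder_inter_F, act_preimage_cylinder h g Finset.inter_subset_right]
  exact MeasurableSet.iUnion fun j => measurableSet_cylinder _ _

theorem measurableSet_act_dom (h : 𝒯.IsWeakCF) (g : G) :
    MeasurableSet {x | (𝒯.act g x).Dom} := by
  have : {x | (𝒯.act g x).Dom} =
      ⋃ n, {x | ∃ y ∈ 𝒯.act g x, y ∈ 𝒯.cylinder n (𝒯.F n)} := by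
    ext x
    rw [Set.mem_iUnion, Set.mem_ofPred_eq, Part.dom_iff_mem]
    constructor
    · rintro ⟨y, hy⟩
      obtain ⟨n, hn⟩ := Set.mem_iUnion.1 (𝒯.iUnion_cylinder_F.symm ▸ Set.mem_univ y)
      exact ⟨n, y, hy, hn⟩
    · rintro ⟨n, y, hy, -⟩
      exact ⟨y, hy⟩
  rw [this]
  exact MeasurableSet.iUnion fun n => measurableSet_act_preimage_cylinder h g n _

theorem measurable_actFun (h : 𝒯.IsWeakCF) (g : G) : Measurable (𝒯.actFun g) := by
  refine measurable_generateFrom ?_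
  rintro _ ⟨n, A, rfl⟩
  have : 𝒯.actFun g ⁻¹' 𝒯.cylinder n A = {x | ∃ y ∈ 𝒯.act g x, y ∈ 𝒯.cylinder n A} ∪
      ({x | (𝒯.act g x).Dom}ᶜ ∩ 𝒯.cylinder n A) := by
    ext x
    by_cases hx : (𝒯.act g x).Dom
    · have hm := actFun_mem hx
      simp only [Set.mem_preimage, Set.mem_union, Set.mem_ofPred_eq, Set.mem_inter_iff,
        Set.mem_compl_iff, hx, not_true, false_and, or_false]
      exact ⟨fun h1 => ⟨_, hm, h1⟩, fun ⟨y, hy, h1⟩ => act_unique hm hy ▸ h1⟩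
    · have hn : ¬∃ y ∈ 𝒯.act g x, y ∈ 𝒯.cylinder n A := fun ⟨y, hy, _⟩ =>
        hx (Part.dom_iff_mem.2 ⟨y, hy⟩)
      simp only [Set.mem_preimage, Set.mem_union, Set.mem_ofPred_eq, Set.mem_inter_iff,
        Set.mem_compl_iff, hx, hn, not_false_iff, true_and, false_or]
      rw [actFun, dif_neg hx]
  rw [this]
  exact (measurableSet_act_preimage_cylinder h g n A).union
    ((measurableSet_act_dom h g).compl.inter (measurableSet_cylinder n A))

/-- The preimage of `[f]_n` is an increasing union of cylinders whose masses are exactly those in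
the limit condition for `g⁻¹`. -/
theorem measurePreserving_actFun (h : 𝒯.IsWeakCF) (hact : 𝒯.IsMeasurePreserving) (g : G) :
    MeasurePreserving (𝒯.actFun g) 𝒯.haar 𝒯.haar := by
  refine ⟨measurable_actFun h g, Eq.symm ?_⟩
  refine measure_ext h (fun n => haar_cylinder_ne_top h n _) fun n f hf => ?_
  have hf' := Finset.singleton_subset_iff.2 hf
  rw [Measure.map_apply (measurable_actFun h g) (measurableSet_cylinder n _)]
  have hae : 𝒯.actFun g ⁻¹' 𝒯.cylinder n {f} =ᵐ[𝒯.haar]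
      {x | ∃ y ∈ 𝒯.act g x, y ∈ 𝒯.cylinder n {f}} := by
    filter_upwards [ae_actFun_mem h hact g] with x hx
    exact propext ⟨fun h1 => ⟨_, hx, h1⟩, fun ⟨y, hy, h1⟩ => (act_unique hy hx ▸ h1 :)⟩
  rw [measure_congr hae, act_preimage_cylinder h g hf']
  refine tendsto_nhds_unique ?_ (tendsto_measure_iUnion_atTop (monotone_cylinder_pull h g n {f}))
  have hsub : ∀ j, 𝒯.pull g n {f} j ⊆ 𝒯.F (n + j) := fun j => Finset.filter_subset _ _
  simp only [Function.comp_def, haar_cylinder h hf', haar_cylinder h (hsub _)]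
  simp only [pull_eq]
  exact (ENNReal.continuous_ofReal.tendsto _).comp (tendsto_card_inter h hact g⁻¹ hf')

/-- A normalized `(C,F)`-sequence whose `(C,F)`-action is defined almost everywhere. -/
structure IsStandard (𝒯 : CFSeq G) : Prop extends 𝒯.IsCF where
  measurePreserving : 𝒯.IsMeasurePreserving
  normalized : 𝒯.IsNormalized

namespace IsStandard

theorem one_mem_F (h : 𝒯.IsStandard) (n : ℕ) : (1 : G) ∈ 𝒯.F n := (h.normalized n).1

theorem one_mem_C (h : 𝒯.IsStandard) (n : ℕ) : (1 : G) ∈ 𝒯.C n := (h.normalized n).2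

theorem one_mem_block (h : 𝒯.IsStandard) (n j : ℕ) : (1 : G) ∈ 𝒯.block n j := by
  induction j with
  | zero => exact Finset.mem_singleton_self 1
  | succ j ih =>
    have := Finset.mul_mem_mul ih (h.one_mem_C (n + j))
    rwa [mul_one] at this

theorem F_zero (h : 𝒯.IsStandard) : 𝒯.F 0 = {1} := by
  obtain ⟨f, hf⟩ := Finset.card_eq_one.1 h.card_F_zero
  have := h.one_mem_F 0
  rw [hf, Finset.mem_singleton] at this
  rw [hf, this]

/-! ### Invariant measures of the action -/

theorem measurePreserving_actFun (h : 𝒯.IsStandard) (g : G) :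
    MeasurePreserving (𝒯.actFun g) 𝒯.haar 𝒯.haar :=
  CFSeq.measurePreserving_actFun h.toIsWeakCF h.measurePreserving g

theorem ae_actFun_mem (h : 𝒯.IsStandard) (g : G) :
    ∀ᵐ x ∂𝒯.haar, 𝒯.actFun g x ∈ 𝒯.act g x :=
  CFSeq.ae_actFun_mem h.toIsWeakCF h.measurePreserving g

theorem ae_actFun_mul (h : 𝒯.IsStandard) (g g' : G) :
    ∀ᵐ x ∂𝒯.haar, 𝒯.actFun g (𝒯.actFun g' x) = 𝒯.actFun (g * g') x := by
  filter_upwards [h.ae_actFun_mem g', h.ae_actFun_mem (g * g'),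
    (h.measurePreserving_actFun g').quasiMeasurePreserving.ae (h.ae_actFun_mem g)] with x h1 h2 h3
  exact act_unique (mem_act_mul h1 h3) h2

theorem ae_actFun_inv (h : 𝒯.IsStandard) (g : G) :
    ∀ᵐ x ∂𝒯.haar, 𝒯.actFun g⁻¹ (𝒯.actFun g x) = x := by
  filter_upwards [h.ae_actFun_mul g⁻¹ g, h.ae_actFun_mem 1] with x h1 h2
  rw [h1, inv_mul_cancel]
  exact mem_act_one.1 h2

theorem ae_mem_cylinder_smul_iff (h : 𝒯.IsStandard) {g : G} {n : ℕ} {A : Finset G}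
    (hA : A ⊆ 𝒯.F n) (hgA : g • A ⊆ 𝒯.F n) :
    ∀ᵐ x ∂𝒯.haar, 𝒯.actFun g x ∈ 𝒯.cylinder n (g • A) ↔ x ∈ 𝒯.cylinder n A := by
  filter_upwards [h.ae_actFun_mem g] with x hx
  exact mem_cylinder_smul_iff h.toIsWeakCF hA hgA hx

theorem haar_cylinder_zero (h : 𝒯.IsStandard) : 𝒯.haar (𝒯.cylinder 0 {1}) = 1 := by
  rw [haar_cylinder_singleton h.toIsWeakCF (h.one_mem_F 0)]
  simp [levelMass]

theorem haar_ne_zero (h : 𝒯.IsStandard) : 𝒯.haar ≠ 0 := by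
  intro h0
  have := h.haar_cylinder_zero
  simp [h0] at this

/-- An invariant measure is determined by its value on `X_0`. -/
theorem eq_smul_haar_of_ne_top (h : 𝒯.IsStandard) {ν : Measure 𝒯.Space}
    (hν : ∀ g, MeasurePreserving (𝒯.actFun g) ν ν) (hac : ν ≪ 𝒯.haar)
    (hfin : ν (𝒯.cylinder 0 {1}) ≠ ⊤) : ν = ν (𝒯.cylinder 0 {1}) • 𝒯.haar := by
  have hw := h.toIsWeakCF
  -- `T_f` carries `[1]_n` onto `[f]_n` mod 0, so the levels of one tower have equal mass.
  have h1 : ∀ n, ∀ f ∈ 𝒯.F n, ν (𝒯.cylinder n {f}) = ν (𝒯.cylinder n {1}) := by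
    intro n f hf
    rw [← (hν f).measure_preimage (measurableSet_cylinder n {f}).nullMeasurableSet]
    have hs : f • ({1} : Finset G) = {f} := by simp
    have := h.ae_mem_cylinder_smul_iff (g := f) (n := n)
      (Finset.singleton_subset_iff.2 (h.one_mem_F n))
      (by rw [hs]; exact Finset.singleton_subset_iff.2 hf)
    rw [hs] at this
    refine measure_congr ?_
    filter_upwards [hac.ae_le this] with x hx using propext hx
  have h2 : ∀ n, ν (𝒯.cylinder n {1}) =
      ν (𝒯.cylinder 0 {1}) * ENNReal.ofReal (𝒯.levelMass n) := by
    intro n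
    induction n with
    | zero => simp [levelMass]
    | succ n ih =>
      -- `[1]_n` is the union of `#C_{n+1}` levels of the next tower.
      have h3 : ν (𝒯.cylinder n {1}) = (𝒯.C n).card * ν (𝒯.cylinder (n + 1) {1}) := by
        rw [← cylinder_succ hw (Finset.singleton_subset_iff.2 (h.one_mem_F n)),
          measure_cylinder hw, Finset.sum_congr rfl fun f hf => h1 (n + 1) f ?_, Finset.sum_const,
          nsmul_eq_mul, Finset.singleton_one, one_mul]
        exact h.mul_subset n (Finset.mul_subset_mul_right
          (Finset.singleton_subset_iff.2 (h.one_mem_F n)) hf)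
      rw [ih, ← levelMass_succ hw, ENNReal.ofReal_mul (Nat.cast_nonneg _), ENNReal.ofReal_natCast,
        mul_left_comm] at h3
      exact ((ENNReal.mul_right_inj (Nat.cast_ne_zero.2 (h.C_nonempty n).card_pos.ne')
        (ENNReal.natCast_ne_top _)).1 h3).symm
  refine measure_ext hw (fun n => ?_) fun n f hf => ?_
  · rw [measure_cylinder hw, Finset.sum_congr rfl (h1 n), h2]
    exact (ENNReal.sum_lt_top.2 fun f _ =>
      ENNReal.mul_lt_top hfin.lt_top ENNReal.ofReal_lt_top).ne
  · rw [h1 n f hf, h2, Measure.smul_apply, haar_cylinder_singleton hw hf, smul_eq_mul]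

/-- The density of one invariant measure with respect to another is an invariant function: its
integral over `T_g⁻¹ s'` does not change under composition with `T_g`, and mod 0 every measurable
set has the form `T_g⁻¹ s'`. -/
theorem ae_comp_actFun_eq (h : 𝒯.IsStandard) {ν : Measure 𝒯.Space} [SigmaFinite ν]
    (hν : ∀ g, MeasurePreserving (𝒯.actFun g) ν ν) (hac : ν ≪ 𝒯.haar) (g : G) :
    (fun x => ν.rnDeriv 𝒯.haar (𝒯.actFun g x)) =ᵐ[𝒯.haar] ν.rnDeriv 𝒯.haar := by
  have := sigmaFinite_haar h.toIsWeakCF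
  have hmp := h.measurePreserving_actFun g
  have hρ := Measure.measurable_rnDeriv ν 𝒯.haar
  have hdens : ∀ s, MeasurableSet s → ∫⁻ x in s, ν.rnDeriv 𝒯.haar x ∂𝒯.haar = ν s := by
    intro s _
    exact Measure.setLIntegral_rnDeriv hac s
  refine ae_eq_of_forall_setLIntegral_eq_of_sigmaFinite (hρ.comp hmp.measurable) hρ
    fun s hs _ => ?_
  have hs' : MeasurableSet (𝒯.actFun g⁻¹ ⁻¹' s) :=
    (h.measurePreserving_actFun g⁻¹).measurable hs
  have hss : 𝒯.actFun g ⁻¹' (𝒯.actFun g⁻¹ ⁻¹' s) =ᵐ[𝒯.haar] s := by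
    filter_upwards [h.ae_actFun_inv g] with x hx
    exact propext (show 𝒯.actFun g⁻¹ (𝒯.actFun g x) ∈ s ↔ x ∈ s by rw [hx])
  rw [← setLIntegral_congr hss, ← setLIntegral_congr hss,
    hmp.setLIntegral_comp_preimage hs' hρ, hdens _ hs', hdens _ (hmp.measurable hs'),
    (hν g).measure_preimage hs'.nullMeasurableSet]

/-- Every absolutely continuous `σ`-finite invariant measure is a multiple of the Haar measure. -/
theorem exists_eq_smul_haar (h : 𝒯.IsStandard) {ν : Measure 𝒯.Space} [SigmaFinite ν]
    (hν : ∀ g, MeasurePreserving (𝒯.actFun g) ν ν) (hac : ν ≪ 𝒯.haar) :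
    ∃ c : ENNReal, c ≠ ⊤ ∧ ν = c • 𝒯.haar := by
  have := sigmaFinite_haar h.toIsWeakCF
  have hρ := Measure.measurable_rnDeriv ν 𝒯.haar
  have hE : ∀ M : ℕ, MeasurableSet {x | ν.rnDeriv 𝒯.haar x ≤ M} := fun M =>
    measurableSet_le hρ measurable_const
  -- Finiteness of `ν` on `X_0` is obtained from boundedness of the density. Some sublevel set has
  -- positive measure, and it will turn out to be conull.
  obtain ⟨M, hM⟩ : ∃ M : ℕ, 𝒯.haar {x | ν.rnDeriv 𝒯.haar x ≤ M} ≠ 0 := by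
    by_contra! hcon
    have h0 : 𝒯.haar (⋃ M : ℕ, {x | ν.rnDeriv 𝒯.haar x ≤ M}) = 0 := measure_iUnion_null hcon
    refine h.haar_ne_zero (ae_eq_bot.1 (eventually_false_iff_eq_bot.1 ?_))
    filter_upwards [Measure.rnDeriv_lt_top ν 𝒯.haar, measure_eq_zero_iff_ae_notMem.1 h0]
      with x hx hx0
    obtain ⟨M, hM⟩ := ENNReal.exists_nat_gt hx.ne
    exact hx0 (Set.mem_iUnion.2 ⟨M, hM.le⟩)
  have hinv : ∀ g, MeasurePreserving (𝒯.actFun g)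
      (𝒯.haar.restrict {x | ν.rnDeriv 𝒯.haar x ≤ M})
      (𝒯.haar.restrict {x | ν.rnDeriv 𝒯.haar x ≤ M}) := by
    intro g
    have h1 := (h.measurePreserving_actFun g).restrict_preimage (hE M)
    rwa [Measure.restrict_congr_set (s := 𝒯.actFun g ⁻¹' {x | ν.rnDeriv 𝒯.haar x ≤ M})
      (t := {x | ν.rnDeriv 𝒯.haar x ≤ M})] at h1
    filter_upwards [h.ae_comp_actFun_eq hν hac g] with x hx
    exact propext (show ν.rnDeriv 𝒯.haar (𝒯.actFun g x) ≤ M ↔ ν.rnDeriv 𝒯.haar x ≤ M by rw [hx])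
  have hX0 : 𝒯.haar (𝒯.cylinder 0 {1}) ≠ ⊤ := haar_cylinder_ne_top h.toIsWeakCF _ _
  -- Haar measure restricted to the invariant sublevel set is finite on `X_0`, hence a multiple of
  -- Haar measure. Evaluated on the complement, this makes either the multiple or the complement
  -- null.
  have hsm := h.eq_smul_haar_of_ne_top hinv Measure.restrict_le_self.absolutelyContinuous
    (ne_top_of_le_ne_top hX0 (Measure.restrict_le_self _))
  have hcompl : 𝒯.haar {x | ν.rnDeriv 𝒯.haar x ≤ M}ᶜ = 0 := by
    have h2 := congrArg (fun m : Measure 𝒯.Space => m {x | ν.rnDeriv 𝒯.haar x ≤ M}ᶜ) hsm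
    simp only [Measure.restrict_apply (hE M).compl, Set.compl_inter_self, measure_empty,
      Measure.smul_apply, smul_eq_mul] at h2
    rcases mul_eq_zero.1 h2.symm with h3 | h3
    · rw [h3, zero_smul] at hsm
      exact absurd (Measure.restrict_eq_zero.1 hsm) hM
    · exact h3
  refine ⟨_, ?_, h.eq_smul_haar_of_ne_top hν hac ?_⟩ <;>
  · rw [← Measure.setLIntegral_rnDeriv hac]
    refine ne_top_of_le_ne_top (ENNReal.mul_ne_top (ENNReal.natCast_ne_top M) hX0) ?_
    refine (lintegral_mono_ae ?_).trans_eq (setLIntegral_const _ _)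
    exact ae_restrict_of_ae (measure_eq_zero_iff_ae_notMem.1 hcompl |>.mono fun x hx =>
      not_not.1 hx)

end IsStandard

/-! ### Isomorphisms of actions -/

namespace ActionIso

theorem ae_toFun_actFun (φ : ActionIso 𝒯 𝒯') (h : 𝒯.IsStandard) (g : G) :
    ∀ᵐ x ∂𝒯.haar, φ.toFun (𝒯.actFun g x) = 𝒯'.actFun g (φ.toFun x) := by
  filter_upwards [φ.equivariant g, h.ae_actFun_mem g] with x ⟨y, hy, hy'⟩ hx
  rw [act_unique hx hy]
  exact act_unique hy' (actFun_mem (Part.dom_iff_mem.2 ⟨_, hy'⟩))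

/-- The inverse isomorphism. -/
def symm (φ : ActionIso 𝒯 𝒯') (h : 𝒯.IsStandard) : ActionIso 𝒯' 𝒯 where
  toFun := φ.invFun
  invFun := φ.toFun
  quasi := φ.quasi_inv
  quasi_inv := φ.quasi
  left_inv := φ.right_inv
  right_inv := φ.left_inv
  equivariant g := by
    have h1 : ∀ᵐ x ∂𝒯.haar, φ.invFun (φ.toFun (𝒯.actFun g x)) = 𝒯.actFun g x :=
      (h.measurePreserving_actFun g).quasiMeasurePreserving.ae φ.left_inv
    filter_upwards [φ.right_inv, φ.quasi_inv.ae (φ.equivariant g), φ.quasi_inv.ae h1,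
      φ.quasi_inv.ae (h.ae_actFun_mem g)] with y hy ⟨x, hx, hx'⟩ h2 h3
    rw [hy] at hx'
    refine ⟨_, hx', ?_⟩
    rwa [act_unique hx h3, h2]

/-- The image of Haar measure under `φ⁻¹` is invariant, absolutely continuous, and `σ`-finite
because the sets `φ⁻¹ X'_n` exhaust the space; uniqueness of the invariant measure applies. -/
theorem exists_haar_preimage_invFun (φ : ActionIso 𝒯 𝒯') (h : 𝒯.IsStandard)
    (h' : 𝒯'.IsStandard) :
    ∃ c : ENNReal, c ≠ ⊤ ∧ ∀ s, MeasurableSet s → 𝒯'.haar (φ.invFun ⁻¹' s) = c * 𝒯.haar s := by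
  have hm := φ.quasi_inv.measurable
  have hinv : ∀ g, MeasurePreserving (𝒯.actFun g) (𝒯'.haar.map φ.invFun)
      (𝒯'.haar.map φ.invFun) := by
    intro g
    have hg := (h.measurePreserving_actFun g).measurable
    have hg' := h'.measurePreserving_actFun g
    refine ⟨hg, ?_⟩
    rw [Measure.map_map hg hm]
    have hae : 𝒯.actFun g ∘ φ.invFun =ᵐ[𝒯'.haar] φ.invFun ∘ 𝒯'.actFun g := by
      filter_upwards [(φ.symm h).ae_toFun_actFun h' g] with y hy using hy.symm
    rw [Measure.map_congr hae, ← Measure.map_map hm hg'.measurable, hg'.map_eq]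
  have hσ : SigmaFinite (𝒯'.haar.map φ.invFun) := by
    refine ⟨⟨⟨fun n => φ.toFun ⁻¹' 𝒯'.cylinder n (𝒯'.F n), fun _ => trivial, fun n => ?_, ?_⟩⟩⟩
    · rw [Measure.map_apply hm (φ.quasi.measurable (measurableSet_cylinder _ _))]
      have hae : φ.invFun ⁻¹' (φ.toFun ⁻¹' 𝒯'.cylinder n (𝒯'.F n)) =ᵐ[𝒯'.haar]
          𝒯'.cylinder n (𝒯'.F n) := by
        filter_upwards [φ.right_inv] with y hy
        exact propext (show φ.toFun (φ.invFun y) ∈ 𝒯'.cylinder n (𝒯'.F n) ↔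
          y ∈ 𝒯'.cylinder n (𝒯'.F n) by rw [hy])
      rw [measure_congr hae]
      exact (haar_cylinder_ne_top h'.toIsWeakCF n _).lt_top
    · rw [← Set.preimage_iUnion, iUnion_cylinder_F, Set.preimage_univ]
  obtain ⟨c, hc, hceq⟩ := h.exists_eq_smul_haar hinv φ.quasi_inv.absolutelyContinuous
  refine ⟨c, hc, fun s hs => ?_⟩
  rw [← Measure.map_apply hm hs, hceq, Measure.smul_apply, smul_eq_mul]

theorem exists_haar_preimage_toFun (φ : ActionIso 𝒯 𝒯') (h : 𝒯.IsStandard)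
    (h' : 𝒯'.IsStandard) :
    ∃ c : ENNReal, c ≠ ⊤ ∧ ∀ s, MeasurableSet s → 𝒯.haar (φ.toFun ⁻¹' s) = c * 𝒯'.haar s :=
  (φ.symm h).exists_haar_preimage_invFun h' h

/-! ### Approximation of the images of cylinders by cylinders -/

theorem ae_toFun_mem_cylinder_iff (φ : ActionIso 𝒯 𝒯') (h : 𝒯.IsStandard) (h' : 𝒯'.IsStandard)
    {g : G} {n : ℕ} {A : Finset G} (hA : A ⊆ 𝒯'.F n) (hgA : g • A ⊆ 𝒯'.F n) :
    ∀ᵐ x ∂𝒯.haar, φ.toFun (𝒯.actFun g x) ∈ 𝒯'.cylinder n (g • A) ↔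
      φ.toFun x ∈ 𝒯'.cylinder n A := by
  filter_upwards [φ.ae_toFun_actFun h g, φ.quasi.ae (h'.ae_mem_cylinder_smul_iff hA hgA)]
    with x hx hx'
  rw [hx, hx']

/-- Translation by `f` carries the approximation of the base level to that of the level `f`, so only
the base has to be approximated. -/
theorem haar_symmDiff_smul (φ : ActionIso 𝒯 𝒯') (h : 𝒯.IsStandard) (h' : 𝒯'.IsStandard)
    {l m : ℕ} {J : Finset G} {f : G} (hf : f ∈ 𝒯'.F l) (hJ : J ⊆ 𝒯.F m) (hfJ : f • J ⊆ 𝒯.F m) :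
    𝒯.haar ((φ.toFun ⁻¹' 𝒯'.cylinder l {f}) ∆ 𝒯.cylinder m (f • J)) =
      𝒯.haar ((φ.toFun ⁻¹' 𝒯'.cylinder l {1}) ∆ 𝒯.cylinder m J) := by
  have hm : MeasurableSet ((φ.toFun ⁻¹' 𝒯'.cylinder l {f}) ∆ 𝒯.cylinder m (f • J)) :=
    (φ.quasi.measurable (measurableSet_cylinder _ _)).symmDiff (measurableSet_cylinder _ _)
  rw [← (h.measurePreserving_actFun f).measure_preimage hm.nullMeasurableSet]
  refine measure_congr ?_
  have hs : f • ({1} : Finset G) = {f} := by simp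
  have h1 := φ.ae_toFun_mem_cylinder_iff h h' (g := f)
    (Finset.singleton_subset_iff.2 (h'.one_mem_F l))
    (by rw [hs]; exact Finset.singleton_subset_iff.2 hf)
  rw [hs] at h1
  filter_upwards [h1, h.ae_mem_cylinder_smul_iff hJ hfJ] with x hx1 hx2
  refine propext ?_
  change 𝒯.actFun f x ∈ (φ.toFun ⁻¹' 𝒯'.cylinder l {f}) ∆ 𝒯.cylinder m (f • J) ↔
    x ∈ (φ.toFun ⁻¹' 𝒯'.cylinder l {1}) ∆ 𝒯.cylinder m J
  rw [Set.mem_symmDiff, Set.mem_symmDiff, Set.mem_preimage, Set.mem_preimage, hx1, hx2]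

theorem haar_symmDiff_mul_le (φ : ActionIso 𝒯 𝒯') (h : 𝒯.IsStandard) (h' : 𝒯'.IsStandard)
    {l m : ℕ} {J J' : Finset G} (hJ' : J' ⊆ 𝒯'.F l) (hJ : J ⊆ 𝒯.F m) (hmul : J' * J ⊆ 𝒯.F m) :
    𝒯.haar ((φ.toFun ⁻¹' 𝒯'.cylinder l J') ∆ 𝒯.cylinder m (J' * J)) ≤
      J'.card * 𝒯.haar ((φ.toFun ⁻¹' 𝒯'.cylinder l {1}) ∆ 𝒯.cylinder m J) := by
  have hfJ : ∀ f ∈ J', f • J ⊆ J' * J := fun f hf => Finset.smul_finset_subset_mul hf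
  calc 𝒯.haar ((φ.toFun ⁻¹' 𝒯'.cylinder l J') ∆ 𝒯.cylinder m (J' * J))
      ≤ 𝒯.haar (⋃ f ∈ J', (φ.toFun ⁻¹' 𝒯'.cylinder l {f}) ∆ 𝒯.cylinder m (f • J)) := by
        refine measure_mono ?_
        rintro x (⟨h1, h2⟩ | ⟨h1, h2⟩)
        · rw [Set.mem_preimage, cylinder_eq_biUnion, Set.mem_iUnion₂] at h1
          obtain ⟨f, hf, hx⟩ := h1
          exact Set.mem_iUnion₂.2
            ⟨f, hf, Or.inl ⟨hx, fun hx' => h2 (cylinder_mono (hfJ f hf) hx')⟩⟩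
        · obtain ⟨u, hu, huA, hxu⟩ := exists_path_of_mem_cylinder h1
          obtain ⟨f, hf, s, hs, hfs⟩ := Finset.mem_mul.1 huA
          refine Set.mem_iUnion₂.2 ⟨f, hf, Or.inr ⟨?_, fun hx' => h2 ?_⟩⟩
          · rw [mem_cylinder_iff h.toIsWeakCF hu hxu le_rfl, ← hfs]
            exact Finset.smul_mem_smul_finset hs
          · exact cylinder_mono (Finset.singleton_subset_iff.2 hf) hx'
    _ ≤ ∑ f ∈ J', 𝒯.haar ((φ.toFun ⁻¹' 𝒯'.cylinder l {f}) ∆ 𝒯.cylinder m (f • J)) :=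
        measure_biUnion_finset_le _ _
    _ = _ := by
        rw [Finset.sum_congr rfl fun f hf =>
          φ.haar_symmDiff_smul h h' (hJ' hf) hJ ((hfJ f hf).trans hmul), Finset.sum_const,
          nsmul_eq_mul]

/-- The set `φ⁻¹ [1]_l` meets its translate by `f'⁻¹ f` in a null set if `f ≠ f'` in `F'_l`. -/
theorem ae_not_mem_cylinder_and (φ : ActionIso 𝒯 𝒯') (h : 𝒯.IsStandard) (h' : 𝒯'.IsStandard)
    {l : ℕ} {f f' : G} (hf : f ∈ 𝒯'.F l) (hf' : f' ∈ 𝒯'.F l) (hne : f ≠ f') :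
    ∀ᵐ x ∂𝒯.haar, ¬(φ.toFun x ∈ 𝒯'.cylinder l {1} ∧
      φ.toFun (𝒯.actFun (f'⁻¹ * f) x) ∈ 𝒯'.cylinder l {1}) := by
  filter_upwards [φ.ae_toFun_actFun h (f'⁻¹ * f), φ.quasi.ae (h'.ae_actFun_mem (f'⁻¹ * f))]
    with x h1 h2 ⟨h3, h4⟩
  rw [h1] at h4
  have key : ∀ g ∈ 𝒯'.F l, ∀ y ∈ 𝒯'.cylinder l {1}, ∃ z ∈ 𝒯'.act g y, z ∈ 𝒯'.cylinder l {g} := by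
    intro g hg y hy
    obtain ⟨z, hz⟩ := exists_mem_act (g := g) (fun f hf => by
      rwa [Finset.mem_singleton.1 hf, mul_one]) hy
    refine ⟨z, hz, mem_cylinder_of_mem_act h'.toIsWeakCF (fun f hf => ?_) hz hy⟩
    rw [Finset.mem_singleton.1 hf, mul_one]
    exact Finset.mem_inter.2 ⟨Finset.mem_singleton_self g, hg⟩
  -- With `y = φ x`, the point `T'_f y` would lie in `[f]_l` and, reached as `T'_{f'} T'_{f'⁻¹ f}
  -- y`, also in `[f']_l`.
  obtain ⟨z, hz, hzf⟩ := key f hf _ h3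
  obtain ⟨z', hz', hzf'⟩ := key f' hf' _ h4
  have h5 := mem_act_mul h2 hz'
  rw [mul_inv_cancel_left] at h5
  rw [act_unique h5 hz] at hzf'
  exact Set.disjoint_left.1 (disjoint_cylinder h'.toIsWeakCF l (Finset.disjoint_singleton.2 hne))
    hzf hzf'

theorem haar_preimage_ne_top (φ : ActionIso 𝒯 𝒯') (h : 𝒯.IsStandard) (h' : 𝒯'.IsStandard)
    (l : ℕ) (A : Finset G) : 𝒯.haar (φ.toFun ⁻¹' 𝒯'.cylinder l A) ≠ ⊤ := by
  obtain ⟨c, hc, hceq⟩ := φ.exists_haar_preimage_toFun h h'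
  rw [hceq _ (measurableSet_cylinder _ _)]
  exact ENNReal.mul_ne_top hc (haar_cylinder_ne_top h'.toIsWeakCF _ _)

/-- The set `φ⁻¹ [1]_l` is approximated by cylinders `[J]_m` with `F'_l J ⊆ F_m`. -/
theorem exists_cylinder_approx (φ : ActionIso 𝒯 𝒯') (h : 𝒯.IsStandard) (h' : 𝒯'.IsStandard)
    (l K : ℕ) {κ : ENNReal} (hκ : 0 < κ) :
    ∃ m > K, ∃ J ⊆ 𝒯.F m, (∀ f ∈ 𝒯'.F l, ∀ s ∈ J, f * s ∈ 𝒯.F m) ∧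
      𝒯.haar ((φ.toFun ⁻¹' 𝒯'.cylinder l {1}) ∆ 𝒯.cylinder m J) < κ := by
  have hw := h.toIsWeakCF
  have hB : MeasurableSet (φ.toFun ⁻¹' 𝒯'.cylinder l {1}) :=
    φ.quasi.measurable (measurableSet_cylinder _ _)
  obtain ⟨n, A, hA, hAB⟩ := exists_cylinder_symmDiff_lt hw hB
    (φ.haar_preimage_ne_top h h' l {1}) (ENNReal.half_pos hκ.ne')
  -- Elements that some `f ∈ F'_l` pushes out of the tower will be discarded. There are finitely
  -- many `f`, so the discarded mass is small at a deep enough level.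
  have hlim : Tendsto (fun j => ∑ f ∈ 𝒯'.F l,
      𝒯.haar (𝒯.cylinder n A \ 𝒯.cylinder (n + j) (𝒯.keep f n A j))) atTop (nhds 0) := by
    have := tendsto_finsetSum (𝒯'.F l) fun f _ =>
      tendsto_haar_sdiff_keep hw h.measurePreserving f hA
    rwa [Finset.sum_const_zero] at this
  obtain ⟨j, hj, hjK⟩ := ((hlim.eventually (gt_mem_nhds (ENNReal.half_pos hκ.ne'))).and
    (eventually_gt_atTop K)).exists
  refine ⟨n + j, by omega, (A * 𝒯.block n j).filter fun s => ∀ f ∈ 𝒯'.F l, f * s ∈ 𝒯.F (n + j),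
    (Finset.filter_subset _ _).trans (mul_block_subset hw hA j),
    fun f hf s hs => (Finset.mem_filter.1 hs).2 f hf, ?_⟩
  refine (measure_symmDiff_le _ (𝒯.cylinder n A) _).trans_lt ?_
  rw [← ENNReal.add_halves κ]
  refine ENNReal.add_lt_add hAB (lt_of_le_of_lt ?_ hj)
  refine (measure_mono ?_).trans (measure_biUnion_finset_le (𝒯'.F l) _)
  rintro x (⟨hx, hx'⟩ | ⟨hx, hx'⟩)
  · have hx2 := hx
    rw [← cylinder_add hw hA j] at hx2
    obtain ⟨u, hu, huA, hxu⟩ := exists_path_of_mem_cylinder hx2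
    rw [mem_cylinder_iff hw hu hxu le_rfl, Finset.mem_filter] at hx'
    push Not at hx'
    obtain ⟨f, hf, hfu⟩ := hx' huA
    refine Set.mem_iUnion₂.2 ⟨f, hf, hx, ?_⟩
    rw [mem_cylinder_iff hw hu hxu le_rfl, mem_keep]
    exact fun h3 => hfu h3.2
  · rw [← cylinder_add hw hA j] at hx'
    exact absurd (cylinder_mono (Finset.filter_subset _ _) hx) hx'

/-- The set `φ⁻¹ [1]_l` is approximated by cylinders `[J]_m` such that the product `F'_l J ⊆ F_m`
is direct. -/
theorem exists_cylinder_approx_injOn (φ : ActionIso 𝒯 𝒯') (h : 𝒯.IsStandard)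
    (h' : 𝒯'.IsStandard) (l K : ℕ) {δ : ENNReal} (hδ : δ ≠ 0) :
    ∃ m > K, ∃ J ⊆ 𝒯.F m, 𝒯'.F l * J ⊆ 𝒯.F m ∧
      Set.InjOn (fun p : G × G => p.1 * p.2) (𝒯'.F l ×ˢ J : Finset (G × G)) ∧
      𝒯.haar ((φ.toFun ⁻¹' 𝒯'.cylinder l {1}) ∆ 𝒯.cylinder m J) < δ := by
  have hw := h.toIsWeakCF
  -- With `N` pairs `(f, f')`, the removed part costs at most `(N + 1)` times the measure of `D`,
  -- and the original error adds one more: hence `N + 2`.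
  obtain ⟨κ, hκ, hκδ⟩ := ENNReal.exists_nnreal_pos_mul_lt
    (a := ((𝒯'.F l ×ˢ 𝒯'.F l).card + 2 : ℕ)) (ENNReal.natCast_ne_top _) hδ
  obtain ⟨m, hmK, J₀, hJ₀, hmul, hlt⟩ := φ.exists_cylinder_approx h h' l K
    (ENNReal.coe_pos.2 hκ)
  set B := φ.toFun ⁻¹' 𝒯'.cylinder l {1} with hBdef
  have hB : MeasurableSet B := φ.quasi.measurable (measurableSet_cylinder _ _)
  set D := B ∆ 𝒯.cylinder m J₀ with hD
  have hDm : MeasurableSet D := hB.symmDiff (measurableSet_cylinder _ _)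
  -- The elements `s` that spoil directness, by `f s = f' s'` with `s' ∈ J₀`.
  let P : G → Prop := fun s => ∃ f ∈ 𝒯'.F l, ∃ f' ∈ 𝒯'.F l, f ≠ f' ∧ f'⁻¹ * f * s ∈ J₀
  classical
  have hbad : 𝒯.haar (𝒯.cylinder m (J₀.filter P)) ≤
      𝒯.haar D + (𝒯'.F l ×ˢ 𝒯'.F l).card * 𝒯.haar D := by
    have hae : ∀ᵐ x ∂𝒯.haar, ∀ q : ((𝒯'.F l ×ˢ 𝒯'.F l : Finset (G × G)) : Type _),
        𝒯.actFun (q.1.2⁻¹ * q.1.1) x ∈ 𝒯.act (q.1.2⁻¹ * q.1.1) x ∧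
        (q.1.1 ≠ q.1.2 → ¬(φ.toFun x ∈ 𝒯'.cylinder l {1} ∧
          φ.toFun (𝒯.actFun (q.1.2⁻¹ * q.1.1) x) ∈ 𝒯'.cylinder l {1})) := by
      refine ae_all_iff.2 fun q => ?_
      have hq := Finset.mem_product.1 q.2
      refine (h.ae_actFun_mem _).and ?_
      by_cases hne : q.1.1 = q.1.2
      · exact Eventually.of_forall fun x hx => absurd hne hx
      · filter_upwards [φ.ae_not_mem_cylinder_and h h' hq.1 hq.2 hne] with x hx _ using hx
    calc 𝒯.haar (𝒯.cylinder m (J₀.filter P))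
        ≤ 𝒯.haar (D ∪ ⋃ q ∈ 𝒯'.F l ×ˢ 𝒯'.F l, 𝒯.actFun (q.2⁻¹ * q.1) ⁻¹' D) := by
          refine measure_mono_ae ?_
          filter_upwards [hae] with x hx hxP
          obtain ⟨u, hu, huA, hxu⟩ := exists_path_of_mem_cylinder hxP
          obtain ⟨huJ, f, hf, f', hf', hne, hff⟩ := Finset.mem_filter.1 huA
          have hq : (f, f') ∈ 𝒯'.F l ×ˢ 𝒯'.F l := Finset.mem_product.2 ⟨hf, hf'⟩
          obtain ⟨hx1, hx2⟩ := hx ⟨(f, f'), hq⟩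
          have hxJ : x ∈ 𝒯.cylinder m J₀ := (mem_cylinder_iff hw hu hxu le_rfl _).2 huJ
          -- A point over a bad `s` is in `D` if it is outside `B`. Otherwise its translate by `f'⁻¹
          -- f` lies in `[J₀]_m` but almost surely not in `B`, so the translate is in `D`.
          by_cases hxB : x ∈ B
          · refine Or.inr (Set.mem_iUnion₂.2 ⟨(f, f'), hq, Or.inr ⟨?_, fun hB2 =>
              hx2 hne ⟨hxB, hB2⟩⟩⟩)
            refine mem_cylinder_of_mem_act hw (A := {u m}) (fun s hs => ?_) hx1
              ((mem_cylinder_iff hw hu hxu le_rfl _).2 (Finset.mem_singleton_self _))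
            rw [Finset.mem_singleton.1 hs]
            exact Finset.mem_inter.2 ⟨hff, hJ₀ hff⟩
          · exact Or.inl (Or.inr ⟨hxJ, hxB⟩)
      _ ≤ 𝒯.haar D + ∑ q ∈ 𝒯'.F l ×ˢ 𝒯'.F l, 𝒯.haar (𝒯.actFun (q.2⁻¹ * q.1) ⁻¹' D) :=
          (measure_union_le _ _).trans (add_le_add_right (measure_biUnion_finset_le _ _) _)
      _ = _ := by
          rw [Finset.sum_congr rfl fun q _ =>
            (h.measurePreserving_actFun (q.2⁻¹ * q.1)).measure_preimage hDm.nullMeasurableSet,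
            Finset.sum_const, nsmul_eq_mul]
  refine ⟨m, hmK, J₀ \ J₀.filter P, Finset.sdiff_subset.trans hJ₀, ?_, ?_, ?_⟩
  · rintro _ hx
    obtain ⟨f, hf, s, hs, rfl⟩ := Finset.mem_mul.1 hx
    exact hmul f hf s (Finset.mem_sdiff.1 hs).1
  · rintro ⟨f, s⟩ hp ⟨f', s'⟩ hp' (e : f * s = f' * s')
    obtain ⟨hf, hs⟩ := Finset.mem_product.1 hp
    obtain ⟨hf', hs'⟩ := Finset.mem_product.1 hp'
    have hff : f = f' := by
      by_contra hne
      refine (Finset.mem_sdiff.1 hs).2 (Finset.mem_filter.2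
        ⟨(Finset.mem_sdiff.1 hs).1, f, hf, f', hf', hne, ?_⟩)
      have e' : f'⁻¹ * f * s = s' := by rw [mul_assoc, e, inv_mul_cancel_left]
      exact e' ▸ (Finset.mem_sdiff.1 hs').1
    subst hff
    rw [mul_left_cancel e]
  · calc 𝒯.haar (B ∆ 𝒯.cylinder m (J₀ \ J₀.filter P))
        ≤ 𝒯.haar (D ∪ 𝒯.cylinder m (J₀.filter P)) := by
          rw [cylinder_sdiff hw]
          refine measure_mono fun x hx => ?_
          simp only [hD, Set.mem_symmDiff, Set.mem_union, Set.mem_sdiff] at hx ⊢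
          tauto
      _ ≤ 𝒯.haar D + (𝒯.haar D + (𝒯'.F l ×ˢ 𝒯'.F l).card * 𝒯.haar D) :=
          (measure_union_le _ _).trans (add_le_add_right hbad _)
      _ = 𝒯.haar D * ((𝒯'.F l ×ˢ 𝒯'.F l).card + 2 : ℕ) := by
          push_cast
          ring
      _ ≤ κ * ((𝒯'.F l ×ˢ 𝒯'.F l).card + 2 : ℕ) := by
          gcongr
      _ < δ := hκδ

/-- Both `[C_{k+1} ⋯ C_m]_m = [1]_k` and `[J' J]_m` are within `e μ([1]_k)` of `φ⁻¹[J']_l`, whence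
the bound `2 e`. Positivity of the overlap is carried along separately because `e` may exceed `1`,
and then small error does not force overlap. -/
theorem exists_half_step (φ : ActionIso 𝒯 𝒯') (h : 𝒯.IsStandard) (h' : 𝒯'.IsStandard)
    {k l : ℕ} (hkl : k < l) {J' : Finset G} (hJ' : 𝒯.F k * J' ⊆ 𝒯'.F l) {e : ℝ} (he : 0 < e)
    (hsymm : 𝒯.haar (𝒯.cylinder k {1} ∆ (φ.toFun ⁻¹' 𝒯'.cylinder l J')) <
      ENNReal.ofReal e * 𝒯.haar (𝒯.cylinder k {1}))
    (hinter : 𝒯.haar (𝒯.cylinder k {1} ∩ (φ.toFun ⁻¹' 𝒯'.cylinder l J')) ≠ 0)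
    {η : ENNReal} (hη : η ≠ 0) :
    ∃ m > l, ∃ J ⊆ 𝒯.F m, 𝒯'.F l * J ⊆ 𝒯.F m ∧
      Set.InjOn (fun p : G × G => p.1 * p.2) (𝒯'.F l ×ˢ J : Finset (G × G)) ∧
      𝒯'.haar (𝒯'.cylinder l {1} ∆ (φ.invFun ⁻¹' 𝒯.cylinder m J)) < η ∧
      𝒯'.haar (𝒯'.cylinder l {1} ∩ (φ.invFun ⁻¹' 𝒯.cylinder m J)) ≠ 0 ∧
      (((J' * J) ∆ 𝒯.block k (m - k)).card : ℝ) / ((𝒯.block k (m - k)).card : ℝ) < 2 * e ∧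
      ((J' * J) ∩ 𝒯.block k (m - k)).Nonempty := by
  have hw := h.toIsWeakCF
  have hw' := h'.toIsWeakCF
  have hX : 𝒯.haar (𝒯.cylinder k {1}) = ENNReal.ofReal (𝒯.levelMass k) :=
    haar_cylinder_singleton hw (h.one_mem_F k)
  have hX' : 𝒯'.haar (𝒯'.cylinder l {1}) ≠ 0 := by
    rw [haar_cylinder_singleton hw' (h'.one_mem_F l)]
    exact (ENNReal.ofReal_pos.2 (levelMass_pos hw' l)).ne'
  have hX0 : 𝒯.haar (𝒯.cylinder k {1}) ≠ 0 := by
    rw [hX]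
    exact (ENNReal.ofReal_pos.2 (levelMass_pos hw k)).ne'
  obtain ⟨c, hc, hceq⟩ := φ.exists_haar_preimage_invFun h h'
  -- `δ₁` controls the error seen through `φ⁻¹`, which scales by `c`; below the mass of `[1]_l` it
  -- leaves a positive overlap. `δ₂` controls the error of `#J'` translates, kept below the given
  -- overlap so that `J' * J` meets the block.
  obtain ⟨δ₁, hδ₁, hδ₁'⟩ := ENNReal.exists_nnreal_pos_mul_lt hc
    (b := min η (𝒯'.haar (𝒯'.cylinder l {1}))) (by simp [min_eq_iff, hη, hX'])
  obtain ⟨δ₂, hδ₂, hδ₂'⟩ := ENNReal.exists_nnreal_pos_mul_lt (ENNReal.natCast_ne_top J'.card)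
    (b := min (ENNReal.ofReal e * 𝒯.haar (𝒯.cylinder k {1}))
      (𝒯.haar (𝒯.cylinder k {1} ∩ (φ.toFun ⁻¹' 𝒯'.cylinder l J'))))
    (by simp [min_eq_iff, hinter, hX0, he])
  obtain ⟨m, hml, J, hJ, hmul, hinj, hlt⟩ := φ.exists_cylinder_approx_injOn h h' l l
    (δ := min δ₁ δ₂) (lt_min (ENNReal.coe_pos.2 hδ₁) (ENNReal.coe_pos.2 hδ₂)).ne'
  have hJ'F : J' ⊆ 𝒯'.F l := fun s hs => hJ' (by
    simpa using Finset.mul_mem_mul (h.one_mem_F k) hs)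
  have hmul' : J' * J ⊆ 𝒯.F m := (Finset.mul_subset_mul_right hJ'F).trans hmul
  have hm1 : 𝒯'.haar (𝒯'.cylinder l {1} ∆ (φ.invFun ⁻¹' 𝒯.cylinder m J)) <
      min η (𝒯'.haar (𝒯'.cylinder l {1})) := by
    have hae : (𝒯'.cylinder l {1} ∆ (φ.invFun ⁻¹' 𝒯.cylinder m J) : Set _) =ᵐ[𝒯'.haar]
        φ.invFun ⁻¹' ((φ.toFun ⁻¹' 𝒯'.cylinder l {1}) ∆ 𝒯.cylinder m J) := by
      filter_upwards [φ.right_inv] with y hy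
      refine propext ?_
      change y ∈ 𝒯'.cylinder l {1} ∆ (φ.invFun ⁻¹' 𝒯.cylinder m J) ↔
        φ.invFun y ∈ (φ.toFun ⁻¹' 𝒯'.cylinder l {1}) ∆ 𝒯.cylinder m J
      rw [Set.mem_symmDiff, Set.mem_symmDiff, Set.mem_preimage, Set.mem_preimage, hy]
    rw [measure_congr hae, hceq _ ((φ.quasi.measurable
      (measurableSet_cylinder _ _)).symmDiff (measurableSet_cylinder _ _)), mul_comm]
    refine lt_of_le_of_lt ?_ hδ₁'
    gcongr
    exact hlt.le.trans (min_le_left _ _)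
  have hm2 : 𝒯.haar ((φ.toFun ⁻¹' 𝒯'.cylinder l J') ∆ 𝒯.cylinder m (J' * J)) <
      min (ENNReal.ofReal e * 𝒯.haar (𝒯.cylinder k {1}))
        (𝒯.haar (𝒯.cylinder k {1} ∩ (φ.toFun ⁻¹' 𝒯'.cylinder l J'))) := by
    refine (φ.haar_symmDiff_mul_le h h' hJ'F hJ hmul').trans_lt (lt_of_le_of_lt ?_ hδ₂')
    rw [mul_comm]
    gcongr
    exact hlt.le.trans (min_le_right _ _)
  have hblock : 𝒯.cylinder k {1} = 𝒯.cylinder m (𝒯.block k (m - k)) := by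
    rw [← cylinder_of_le hw (hkl.le.trans hml.le) (Finset.singleton_subset_iff.2 (h.one_mem_F k)),
      Finset.singleton_one, one_mul]
  have hblockF : 𝒯.block k (m - k) ⊆ 𝒯.F m := by
    have := mul_block_subset' hw (hkl.le.trans hml.le)
      (Finset.singleton_subset_iff.2 (h.one_mem_F k))
    rwa [Finset.singleton_one, one_mul] at this
  refine ⟨m, hml, J, hJ, hmul, hinj, hm1.trans_le (min_le_left _ _), ?_, ?_, ?_⟩
  · intro h0
    refine (hm1.trans_le (min_le_right _ _)).not_ge ?_
    calc 𝒯'.haar (𝒯'.cylinder l {1})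
        ≤ 𝒯'.haar (𝒯'.cylinder l {1} ∩ (φ.invFun ⁻¹' 𝒯.cylinder m J)) +
          𝒯'.haar (𝒯'.cylinder l {1} ∆ (φ.invFun ⁻¹' 𝒯.cylinder m J)) := by
          refine (measure_mono fun x hx => ?_).trans (measure_union_le _ _)
          simp only [Set.mem_symmDiff, Set.mem_union, Set.mem_inter_iff]
          tauto
      _ = _ := by rw [h0, zero_add]
  · have h1 : 𝒯.haar (𝒯.cylinder k {1} ∆ 𝒯.cylinder m (J' * J)) <
        ENNReal.ofReal e * 𝒯.haar (𝒯.cylinder k {1}) +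
          ENNReal.ofReal e * 𝒯.haar (𝒯.cylinder k {1}) :=
      (measure_symmDiff_le _ _ _).trans_lt
        (ENNReal.add_lt_add hsymm (hm2.trans_le (min_le_left _ _)))
    rw [symmDiff_comm (J' * J), div_lt_iff₀ (Nat.cast_pos.2 (block_nonempty hw _ _).card_pos)]
    have hcard : ((𝒯.block k (m - k)).card : ℝ) * 𝒯.levelMass m = 𝒯.levelMass k := by
      have := card_mul_levelMass hw (hkl.le.trans hml.le)
        (Finset.singleton_subset_iff.2 (h.one_mem_F k))
      rwa [Finset.singleton_one, one_mul, Finset.card_one, Nat.cast_one, one_mul] at this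
    rw [hX, hblock, ← cylinder_symmDiff hw, haar_cylinder hw, ← hcard, ← ENNReal.ofReal_mul he.le,
      ← ENNReal.ofReal_add, ENNReal.ofReal_lt_ofReal_iff'] at h1
    · have h2 := h1.1
      rw [← mul_assoc, ← add_mul] at h2
      have := lt_of_mul_lt_mul_right h2 (levelMass_pos hw m).le
      linarith
    · have := levelMass_pos hw m
      positivity
    · have := levelMass_pos hw m
      positivity
    · exact fun s hs => (Finset.mem_symmDiff.1 hs).elim (fun hs => hblockF hs.1)
        fun hs => hmul' hs.1
  · by_contra hne
    rw [Finset.not_nonempty_iff_eq_empty] at hne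
    have hdis : 𝒯.cylinder m (J' * J) ∩ 𝒯.cylinder k {1} = ∅ := by
      rw [hblock, ← cylinder_inter hw, hne, cylinder_empty]
    -- If `J' * J` missed the block, the whole overlap would be contained in the error set.
    refine (hm2.trans_le (min_le_right _ _)).not_ge (measure_mono fun x hx => ?_)
    refine Or.inl ⟨hx.2, fun hx' => ?_⟩
    exact Set.notMem_empty x (hdis ▸ ⟨hx', hx.1⟩)

end ActionIso

/-! ### Decay of the level masses -/

namespace IsStandard

theorem levelMass_le (h : 𝒯.IsStandard) (n : ℕ) : 𝒯.levelMass n ≤ (1 / 2) ^ n := by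
  induction n with
  | zero => simp [levelMass]
  | succ n ih =>
    have h1 := levelMass_succ h.toIsWeakCF n
    have h2 : (2 : ℝ) ≤ (𝒯.C n).card := by exact_mod_cast h.one_lt_card_C n
    have h3 := mul_le_mul_of_nonneg_right h2 (levelMass_pos h.toIsWeakCF (n + 1)).le
    rw [pow_succ]
    linarith

theorem tendsto_levelMass (h : 𝒯.IsStandard) : Tendsto 𝒯.levelMass atTop (nhds 0) :=
  squeeze_zero (fun n => (levelMass_pos h.toIsWeakCF n).le) h.levelMass_le
    (tendsto_pow_atTop_nhds_zero_of_lt_one (by norm_num) (by norm_num))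

end IsStandard

/-! ### Existence of linking data -/

/-- One stage `(k_n, l_n, J_n, J'_n)` of the linking data. -/
structure LinkStage (φ : ActionIso 𝒯 𝒯') (e : ℝ) where
  k : ℕ
  l : ℕ
  J : Finset G
  J' : Finset G
  k_lt_l : k < l
  J_subset : J ⊆ 𝒯.F k
  J'_subset : J' ⊆ 𝒯'.F l
  mul_J'_subset : 𝒯.F k * J' ⊆ 𝒯'.F l
  mul_J'_injOn : Set.InjOn (fun p : G × G => p.1 * p.2) (𝒯.F k ×ˢ J' : Finset (G × G))
  haar_symmDiff_lt : 𝒯.haar (𝒯.cylinder k {1} ∆ (φ.toFun ⁻¹' 𝒯'.cylinder l J')) <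
    ENNReal.ofReal e * 𝒯.haar (𝒯.cylinder k {1})
  haar_inter_ne_zero : 𝒯.haar (𝒯.cylinder k {1} ∩ (φ.toFun ⁻¹' 𝒯'.cylinder l J')) ≠ 0

/-- The relation between consecutive stages of the linking data. -/
structure LinkStage.Follows {φ : ActionIso 𝒯 𝒯'} {e e' : ℝ} (s : LinkStage φ e)
    (t : LinkStage φ e') : Prop where
  l_lt_k : s.l < t.k
  mul_J_subset : 𝒯'.F s.l * t.J ⊆ 𝒯.F t.k
  mul_J_injOn : Set.InjOn (fun p : G × G => p.1 * p.2) (𝒯'.F s.l ×ˢ t.J : Finset (G × G))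
  haar_symmDiff_lt' : 𝒯'.haar (𝒯'.cylinder s.l {1} ∆ (φ.invFun ⁻¹' 𝒯.cylinder t.k t.J)) <
    ENNReal.ofReal e' * 𝒯'.haar (𝒯'.cylinder s.l {1})
  card_symmDiff_lt : (((s.J' * t.J) ∆ 𝒯.block s.k (t.k - s.k)).card : ℝ) /
    ((𝒯.block s.k (t.k - s.k)).card : ℝ) < 2 * e
  card_symmDiff_lt' : (((t.J * t.J') ∆ 𝒯'.block s.l (t.l - s.l)).card : ℝ) /
    ((𝒯'.block s.l (t.l - s.l)).card : ℝ) < 2 * e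
  inter_nonempty : ((s.J' * t.J) ∩ 𝒯.block s.k (t.k - s.k)).Nonempty
  inter_nonempty' : ((t.J * t.J') ∩ 𝒯'.block s.l (t.l - s.l)).Nonempty

/-- A half step for `φ` followed by one for `φ⁻¹`. The second starts with error `e'`, so it gives
the bound `2 e' ≤ 2 e`. -/
theorem LinkStage.exists_follows {φ : ActionIso 𝒯 𝒯'} (h : 𝒯.IsStandard) (h' : 𝒯'.IsStandard)
    {e e' : ℝ} (he' : 0 < e') (hee : e' ≤ e) (s : LinkStage φ e) :
    ∃ t : LinkStage φ e', s.Follows t := by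
  have hX : ∀ {𝒰 : CFSeq G}, 𝒰.IsStandard → ∀ n,
      ENNReal.ofReal e' * 𝒰.haar (𝒰.cylinder n {1}) ≠ 0 := by
    intro 𝒰 h𝒰 n
    rw [haar_cylinder_singleton h𝒰.toIsWeakCF (h𝒰.one_mem_F n)]
    exact mul_ne_zero (ENNReal.ofReal_pos.2 he').ne'
      (ENNReal.ofReal_pos.2 (levelMass_pos h𝒰.toIsWeakCF n)).ne'
  obtain ⟨k, hlk, J, hJ, hmul, hinj, hsymm, hinter, hcard, hne⟩ :=
    φ.exists_half_step h h' s.k_lt_l s.mul_J'_subset (he'.trans_le hee) s.haar_symmDiff_lt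
      s.haar_inter_ne_zero (hX h' s.l)
  obtain ⟨l, hkl, J', hJ', hmul', hinj', hsymm', hinter', hcard', hne'⟩ :=
    (φ.symm h).exists_half_step h' h hlk hmul he' hsymm hinter (hX h k)
  exact ⟨⟨k, l, J, J', hkl, hJ, hJ', hmul', hinj', hsymm', hinter'⟩,
    ⟨hlk, hmul, hinj, hsymm, hcard, hcard'.trans_le (by linarith), hne, hne'⟩⟩

/-- The first stage of the linking data: `J' = {1, f}`, where `φ⁻¹ [f]_l` is not disjoint from
`X_0`. -/
theorem LinkStage.exists_first (φ : ActionIso 𝒯 𝒯') (h : 𝒯.IsStandard) (h' : 𝒯'.IsStandard)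
    {e : ℝ} (he : 1 < e) :
    ∃ s : LinkStage φ e, s.k = 0 ∧ s.J = {1} ∧ 1 ∈ s.J' ∧ s.J'.card ≤ 2 := by
  have hw' := h'.toIsWeakCF
  obtain ⟨c, hc, hceq⟩ := φ.exists_haar_preimage_toFun h h'
  obtain ⟨δ, hδ, hδc⟩ := ENNReal.exists_nnreal_pos_mul_lt hc
    (b := ENNReal.ofReal (e - 1)) (ENNReal.ofReal_pos.2 (by linarith)).ne'
  -- At a deep level two levels pull back to mass below `e - 1`. As `X_0` has mass `1`, the
  -- symmetric difference is then below `e`; this is where `1 < e` is needed.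
  have hmass : ∀ᶠ n in atTop, ENNReal.ofReal (2 * 𝒯'.levelMass n) < δ := by
    have : Tendsto (fun n => ENNReal.ofReal (2 * 𝒯'.levelMass n)) atTop
        (nhds (ENNReal.ofReal (2 * 0))) :=
      (ENNReal.continuous_ofReal.tendsto _).comp (h'.tendsto_levelMass.const_mul 2)
    rw [mul_zero, ENNReal.ofReal_zero] at this
    exact this.eventually (gt_mem_nhds (ENNReal.coe_pos.2 hδ))
  have hmeet : ∀ᶠ n in atTop,
      0 < 𝒯.haar (𝒯.cylinder 0 {1} ∩ φ.toFun ⁻¹' 𝒯'.cylinder n (𝒯'.F n)) := by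
    have hmono : Monotone fun n => 𝒯.cylinder 0 {1} ∩ φ.toFun ⁻¹' 𝒯'.cylinder n (𝒯'.F n) :=
      fun n m hnm => Set.inter_subset_inter_right _
        (Set.preimage_mono (monotone_cylinder_F hw' hnm))
    have := tendsto_measure_iUnion_atTop (μ := 𝒯.haar) hmono
    rw [← Set.inter_iUnion, ← Set.preimage_iUnion, iUnion_cylinder_F, Set.preimage_univ,
      Set.inter_univ, h.haar_cylinder_zero] at this
    exact this.eventually (lt_mem_nhds one_pos)
  obtain ⟨l, h1, h2, hl⟩ := (hmass.and (hmeet.and (eventually_gt_atTop 0))).exists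
  obtain ⟨f, hf, hfpos⟩ : ∃ f ∈ 𝒯'.F l,
      𝒯.haar (𝒯.cylinder 0 {1} ∩ φ.toFun ⁻¹' 𝒯'.cylinder l {f}) ≠ 0 := by
    by_contra! hcon
    refine h2.ne' ?_
    rw [cylinder_eq_biUnion l (𝒯'.F l), Set.preimage_iUnion₂, Set.inter_iUnion₂]
    exact (measure_biUnion_null_iff (Finset.countable_toSet _)).2 hcon
  have hsub : ({1, f} : Finset G) ⊆ 𝒯'.F l :=
    Finset.insert_subset (h'.one_mem_F l) (Finset.singleton_subset_iff.2 hf)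
  refine ⟨⟨0, l, {1}, {1, f}, hl, Finset.singleton_subset_iff.2 (h.one_mem_F 0), hsub, ?_, ?_, ?_,
    ?_⟩, rfl, rfl, Finset.mem_insert_self _ _, Finset.card_le_two⟩
  · rwa [h.F_zero, Finset.singleton_one, one_mul]
  · rintro ⟨a, b⟩ hp ⟨a', b'⟩ hp' (hab : a * b = a' * b')
    have ha := (Finset.mem_product.1 hp).1
    have ha' := (Finset.mem_product.1 hp').1
    rw [h.F_zero, Finset.mem_singleton] at ha ha'
    simp only at ha ha'
    subst ha ha'
    rw [mul_left_cancel hab]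
  · have h3 : 𝒯.haar (φ.toFun ⁻¹' 𝒯'.cylinder l {1, f}) < ENNReal.ofReal (e - 1) := by
      rw [hceq _ (measurableSet_cylinder _ _), haar_cylinder hw' hsub, mul_comm]
      refine lt_of_le_of_lt ?_ hδc
      gcongr
      refine le_trans (ENNReal.ofReal_le_ofReal ?_) h1.le
      have : ((({1, f} : Finset G).card : ℕ) : ℝ) ≤ 2 := by exact_mod_cast Finset.card_le_two
      exact mul_le_mul_of_nonneg_right this (levelMass_pos hw' l).le
    rw [h.haar_cylinder_zero, mul_one]
    calc 𝒯.haar (𝒯.cylinder 0 {1} ∆ (φ.toFun ⁻¹' 𝒯'.cylinder l {1, f}))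
        ≤ 𝒯.haar (𝒯.cylinder 0 {1} ∪ (φ.toFun ⁻¹' 𝒯'.cylinder l {1, f})) := by
          refine measure_mono fun x hx => ?_
          exact hx.elim (fun h => Or.inl h.1) fun h => Or.inr h.1
      _ ≤ 1 + 𝒯.haar (φ.toFun ⁻¹' 𝒯'.cylinder l {1, f}) :=
          (measure_union_le _ _).trans_eq (by rw [h.haar_cylinder_zero])
      _ < 1 + ENNReal.ofReal (e - 1) := ENNReal.add_lt_add_left ENNReal.one_ne_top h3
      _ = ENNReal.ofReal e := by
          rw [← ENNReal.ofReal_one, ← ENNReal.ofReal_add zero_le_one (by linarith)]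
          congr 1
          ring
  · refine fun h0 => hfpos (measure_mono_null ?_ h0)
    exact Set.inter_subset_inter_right _ (Set.preimage_mono (cylinder_mono (by simp)))

theorem exists_linkingData (φ : ActionIso 𝒯 𝒯') (h : 𝒯.IsStandard) (h' : 𝒯'.IsStandard)
    {ε : ℕ → ℝ} (hε_anti : Antitone ε) (hε_pos : ∀ n, 0 < ε n) (hε_one : 1 < ε 1) :
    ∃ D : LinkingData 𝒯 𝒯', D.IsProducedFrom φ ε := by
  obtain ⟨s₀, hk₀, hJ₀, hone, hcard⟩ := LinkStage.exists_first φ h h' hε_one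
  choose next hnext using fun (n : ℕ) (s : LinkStage φ (ε (n + 1))) =>
    s.exists_follows h h' (hε_pos (n + 1 + 1)) (hε_anti (n + 1).le_succ)
  -- Stage `s n` supplies the data of index `n + 1`. Index `0` consists of `k = l = 0` and the sets
  -- `{1}`, so its conditions are checked by hand.
  let s : ∀ n, LinkStage φ (ε (n + 1)) := fun n => Nat.rec s₀ next n
  have hs : ∀ n, (s n).Follows (s (n + 1)) := fun n => hnext n (s n)
  have hs₀ : s 0 = s₀ := rfl
  have hF := h.F_zero
  have hF' := h'.F_zero
  have hinj : Set.InjOn (fun p : G × G => p.1 * p.2)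
      (({1} : Finset G) ×ˢ ({1} : Finset G) : Finset (G × G)) := by
    simp [Set.InjOn]
  let D : LinkingData 𝒯 𝒯' :=
    { k := fun n => Nat.casesOn n 0 fun n => (s n).k
      l := fun n => Nat.casesOn n 0 fun n => (s n).l
      J := fun n => Nat.casesOn n {1} fun n => (s n).J
      J' := fun n => Nat.casesOn n {1} fun n => (s n).J'
      k_zero := rfl
      l_zero := rfl
      k_one := hk₀
      k_lt_l := fun n hn => by
        obtain ⟨n, rfl⟩ := Nat.exists_eq_add_of_le' hn
        exact (s n).k_lt_l
      l_lt_k := fun n hn => by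
        obtain ⟨n, rfl⟩ := Nat.exists_eq_add_of_le' hn
        exact (hs n).l_lt_k
      J_subset := fun n => by
        rcases n with _ | n
        · exact hF.ge
        · exact (s n).J_subset
      J'_subset := fun n => by
        rcases n with _ | n
        · exact hF'.ge
        · exact (s n).J'_subset
      mul_J'_subset := fun n => by
        rcases n with _ | n
        · change 𝒯.F 0 * {1} ⊆ 𝒯'.F 0
          rw [hF, hF', Finset.singleton_one, one_mul]
        · exact (s n).mul_J'_subset
      mul_J'_injOn := fun n => by
        rcases n with _ | n
        · change Set.InjOn (fun p : G × G => p.1 * p.2) (𝒯.F 0 ×ˢ {1} : Finset (G × G))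
          rwa [hF]
        · exact (s n).mul_J'_injOn
      mul_J_subset := fun n => by
        rcases n with _ | n
        · change 𝒯'.F 0 * s₀.J ⊆ 𝒯.F s₀.k
          rw [hk₀, hJ₀, hF, hF', Finset.singleton_one, one_mul]
        · exact (hs n).mul_J_subset
      mul_J_injOn := fun n => by
        rcases n with _ | n
        · change Set.InjOn (fun p : G × G => p.1 * p.2) (𝒯'.F 0 ×ˢ s₀.J : Finset (G × G))
          rwa [hF', hJ₀]
        · exact (hs n).mul_J_injOn }
  have hε_zero : 1 < ε 0 := hε_one.trans_le (hε_anti zero_le_one)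
  have hmem : (1 : G) ∈ 𝒯'.block 0 s₀.l := h'.one_mem_block 0 _
  refine ⟨D, ⟨fun n => ?_, fun n => ?_, fun n hn => ?_, fun n hn => ?_, fun n => ?_, fun n => ?_⟩⟩
  · rcases n with _ | n
    · change ((({1} * s₀.J) ∆ 𝒯.block 0 (s₀.k - 0)).card : ℝ) / _ < _
      rw [hJ₀, hk₀]
      simp [block, Finset.singleton_one, hε_pos]
    · exact (hs n).card_symmDiff_lt
  · rcases n with _ | n
    · change (((s₀.J * s₀.J') ∆ 𝒯'.block 0 (s₀.l - 0)).card : ℝ) /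
        ((𝒯'.block 0 (s₀.l - 0)).card : ℝ) < _
      rw [hJ₀, Finset.singleton_one, one_mul, Nat.sub_zero,
        div_lt_iff₀ (Nat.cast_pos.2 (block_nonempty h'.toIsWeakCF _ _).card_pos)]
      -- Since `1` lies in both sets and `J'` has at most two elements, the difference has at most
      -- `1 + #block ≤ 2 #block` elements, and `1 < ε 0`.
      have hsub : s₀.J' ∆ 𝒯'.block 0 s₀.l ⊆ s₀.J'.erase 1 ∪ 𝒯'.block 0 s₀.l := by
        intro x hx
        rw [Finset.mem_union, Finset.mem_erase]
        rcases Finset.mem_symmDiff.1 hx with hx | hx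
        · exact Or.inl ⟨fun hx1 => hx.2 (hx1 ▸ hmem), hx.1⟩
        · exact Or.inr hx.1
      have h1 := (Finset.card_le_card hsub).trans (Finset.card_union_le _ _)
      have h2 := Finset.card_erase_lt_of_mem hone
      have h3 := (block_nonempty h'.toIsWeakCF 0 s₀.l).card_pos
      have h4 : ((s₀.J' ∆ 𝒯'.block 0 s₀.l).card : ℝ) ≤ 2 * (𝒯'.block 0 s₀.l).card := by
        exact_mod_cast (by omega :
          (s₀.J' ∆ 𝒯'.block 0 s₀.l).card ≤ 2 * (𝒯'.block 0 s₀.l).card)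
      have h5 : (0 : ℝ) < (𝒯'.block 0 s₀.l).card := Nat.cast_pos.2 h3
      nlinarith
    · exact (hs n).card_symmDiff_lt'
  · obtain ⟨n, rfl⟩ := Nat.exists_eq_add_of_le' hn
    exact (s n).haar_symmDiff_lt
  · obtain ⟨n, rfl⟩ := Nat.exists_eq_add_of_le' hn
    exact (hs n).haar_symmDiff_lt'
  · rcases n with _ | n
    · refine ⟨1, ?_⟩
      change 1 ∈ ({1} * s₀.J) ∩ 𝒯.block 0 (s₀.k - 0)
      rw [hJ₀, hk₀]
      simp [block]
    · exact (hs n).inter_nonempty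
  · rcases n with _ | n
    · refine ⟨1, ?_⟩
      change 1 ∈ (s₀.J * s₀.J') ∩ 𝒯'.block 0 (s₀.l - 0)
      rw [hJ₀, Finset.singleton_one, one_mul]
      exact Finset.mem_inter.2 ⟨hone, hmem⟩
    · exact (hs n).inter_nonempty'

/-! ### The linked `(C,F)`-sequences -/

/-- Directness of `F J' ⊆ F'` and of `F' J` makes the triple product `F J' J` direct. -/
theorem disjoint_mul_singleton_of_injOn {F F' J J' : Finset G} (hsub : F * J' ⊆ F')
    (hinj : Set.InjOn (fun p : G × G => p.1 * p.2) (F ×ˢ J' : Finset (G × G)))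
    (hinj' : Set.InjOn (fun p : G × G => p.1 * p.2) (F' ×ˢ J : Finset (G × G))) :
    ∀ c ∈ J' * J, ∀ c' ∈ J' * J, c ≠ c' → Disjoint (F * {c}) (F * {c'}) := by
  intro c hc c' hc' hne
  obtain ⟨a, ha, b, hb, rfl⟩ := Finset.mem_mul.1 hc
  obtain ⟨a', ha', b', hb', rfl⟩ := Finset.mem_mul.1 hc'
  rw [Finset.disjoint_left]
  intro x hx hx'
  obtain ⟨f, hf, c, hc, rfl⟩ := Finset.mem_mul.1 hx
  obtain ⟨f', hf', c', hc', e⟩ := Finset.mem_mul.1 hx'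
  rw [Finset.mem_singleton.1 hc, Finset.mem_singleton.1 hc'] at e
  have h1 := @hinj' (f' * a', b') (Finset.mem_coe.2 (Finset.mem_product.2
    ⟨hsub (Finset.mul_mem_mul hf' ha'), hb'⟩)) (f * a, b) (Finset.mem_coe.2 (Finset.mem_product.2
    ⟨hsub (Finset.mul_mem_mul hf ha), hb⟩)) (by simpa only [mul_assoc] using e)
  obtain ⟨h2, rfl⟩ := Prod.mk.inj h1
  have h3 := @hinj (f', a') (Finset.mem_coe.2 (Finset.mem_product.2 ⟨hf', ha'⟩)) (f, a)
    (Finset.mem_coe.2 (Finset.mem_product.2 ⟨hf, ha⟩)) h2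
  exact hne (by rw [(Prod.mk.inj h3).2])

/-- For `a, a' ∈ J'` and `b, b' ∈ J`, the relation `a⁻¹ a' = b b'⁻¹` says `a b = a' b'`, so `a = a'`
by directness. -/
theorem inv_mul_inter_mul_inv_eq {F J J' : Finset G} (hsub : J' ⊆ F)
    (hinj : Set.InjOn (fun p : G × G => p.1 * p.2) (F ×ˢ J : Finset (G × G)))
    (hJ : J.Nonempty) (hJ' : J'.Nonempty) : (J'⁻¹ * J') ∩ (J * J⁻¹) = {1} := by
  refine Finset.eq_singleton_iff_unique_mem.2 ⟨Finset.mem_inter.2 ⟨?_, ?_⟩, fun x hx => ?_⟩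
  · obtain ⟨a, ha⟩ := hJ'
    exact Finset.mem_mul.2 ⟨a⁻¹, Finset.inv_mem_inv ha, a, ha, inv_mul_cancel a⟩
  · obtain ⟨b, hb⟩ := hJ
    exact Finset.mem_mul.2 ⟨b, hb, b⁻¹, Finset.inv_mem_inv hb, mul_inv_cancel b⟩
  · obtain ⟨hx1, hx2⟩ := Finset.mem_inter.1 hx
    obtain ⟨a, ha, a', ha', rfl⟩ := Finset.mem_mul.1 hx1
    obtain ⟨b, hb, b', hb', e⟩ := Finset.mem_mul.1 hx2
    have e' : a' * b'⁻¹ = a⁻¹ * b := by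
      have : a' = a⁻¹ * (b * b') := by rw [e, inv_mul_cancel_left]
      rw [this, mul_assoc, mul_assoc, mul_inv_cancel, mul_one]
    have h1 := @hinj (a', b'⁻¹) (Finset.mem_coe.2 (Finset.mem_product.2
      ⟨hsub ha', Finset.mem_inv'.1 hb'⟩)) (a⁻¹, b) (Finset.mem_coe.2 (Finset.mem_product.2
      ⟨hsub (Finset.mem_inv'.1 ha), hb⟩)) e'
    rw [(Prod.mk.inj h1).1, mul_inv_cancel]

/-! ### Cardinality estimates for the reductions -/

section Cardinality

variable {P C : ℕ → Finset G} {ε : ℕ → ℝ}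

theorem eventually_card_le_two_mul_card (hC : ∀ n, (C n).Nonempty) (hε : Summable ε)
    (hlt : ∀ n, ((P n ∆ C n).card : ℝ) / ((C n).card : ℝ) < 2 * ε n) :
    ∀ᶠ n in atTop, 3 * ((C n).card : ℝ) ≤ 4 * (P n).card := by
  -- `ε n < 1/8` makes the relative error less than `1/4`. The resulting ratio `3/4` exceeds `1/2`,
  -- so `#C ≥ 2` forces `#P > 1`.
  filter_upwards [hε.tendsto_atTop_zero.eventually (gt_mem_nhds (by norm_num : (0 : ℝ) < 1 / 8))]
    with n hn
  have h1 : (0 : ℝ) < (C n).card := Nat.cast_pos.2 (hC n).card_pos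
  have h2 := (div_lt_iff₀ h1).1 (hlt n)
  have h3 : (C n).card ≤ (P n ∆ C n).card + (P n).card := by
    refine (Finset.card_le_card fun x hx => ?_).trans (Finset.card_union_le _ _)
    rw [Finset.mem_union, Finset.mem_symmDiff]
    tauto
  have h4 : ((C n).card : ℝ) ≤ (P n ∆ C n).card + (P n).card := by exact_mod_cast h3
  nlinarith

theorem eventually_one_lt_card (hC : ∀ n, (C n).Nonempty) (hC1 : ∀ᶠ n in atTop, 1 < (C n).card)
    (hε : Summable ε) (hlt : ∀ n, ((P n ∆ C n).card : ℝ) / ((C n).card : ℝ) < 2 * ε n) :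
    ∀ᶠ n in atTop, 1 < (P n).card := by
  filter_upwards [hC1, eventually_card_le_two_mul_card hC hε hlt] with n h1 h2
  have h3 : 3 * (C n).card ≤ 4 * (P n).card := by exact_mod_cast h2
  omega

theorem card_sdiff_le_symmDiff (A B : Finset G) :
    ((B.card : ℝ) - (A ∩ B).card ≤ (A ∆ B).card) ∧ ((A.card : ℝ) - (A ∩ B).card ≤ (A ∆ B).card) := by
  have h1 : (B \ A).card ≤ (A ∆ B).card := Finset.card_le_card fun x hx =>
    Finset.mem_symmDiff.2 (Or.inr (Finset.mem_sdiff.1 hx))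
  have h2 : (A \ B).card ≤ (A ∆ B).card := Finset.card_le_card fun x hx =>
    Finset.mem_symmDiff.2 (Or.inl (Finset.mem_sdiff.1 hx))
  have h3 := Finset.card_inter_add_card_sdiff B A
  have h4 := Finset.card_inter_add_card_sdiff A B
  rw [Finset.inter_comm] at h3
  rw [sub_le_iff_le_add, sub_le_iff_le_add]
  constructor
  · exact_mod_cast (by omega : B.card ≤ (A ∆ B).card + (A ∩ B).card)
  · exact_mod_cast (by omega : A.card ≤ (A ∆ B).card + (A ∩ B).card)

theorem summable_one_sub_card_inter_div (hC : ∀ n, (C n).Nonempty) (hε : Summable ε)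
    (hlt : ∀ n, ((P n ∆ C n).card : ℝ) / ((C n).card : ℝ) < 2 * ε n) :
    Summable fun n => 1 - ((P n ∩ C n).card : ℝ) / ((C n).card : ℝ) := by
  refine Summable.of_nonneg_of_le (fun n => ?_) (fun n => ?_) (hε.mul_left 2)
  · have h1 : ((P n ∩ C n).card : ℝ) ≤ (C n).card :=
      Nat.cast_le.2 (Finset.card_le_card Finset.inter_subset_right)
    exact sub_nonneg.2 (div_le_one_of_le₀ h1 (Nat.cast_nonneg _))
  · have h1 : (0 : ℝ) < (C n).card := Nat.cast_pos.2 (hC n).card_pos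
    refine le_trans ?_ (hlt n).le
    rw [one_sub_div h1.ne']
    exact div_le_div_of_nonneg_right (card_sdiff_le_symmDiff (P n) (C n)).1 h1.le

theorem summable_one_sub_card_inter_div' (hC : ∀ n, (C n).Nonempty) (hε : Summable ε)
    (hlt : ∀ n, ((P n ∆ C n).card : ℝ) / ((C n).card : ℝ) < 2 * ε n) :
    Summable fun n => 1 - ((P n ∩ C n).card : ℝ) / ((P n).card : ℝ) := by
  -- Dividing by `#P` instead of `#C` costs a factor at most `4/3` for large `n`, and `2 · 4/3 ≤ 4`.
  refine Summable.of_norm_bounded_eventually_nat (hε.mul_left 4) ?_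
  filter_upwards [eventually_card_le_two_mul_card hC hε hlt] with n hn
  have h1 : (0 : ℝ) < (C n).card := Nat.cast_pos.2 (hC n).card_pos
  have h2 : (0 : ℝ) < (P n).card := by linarith
  have h3 : ((P n ∩ C n).card : ℝ) ≤ (P n).card :=
    Nat.cast_le.2 (Finset.card_le_card Finset.inter_subset_left)
  have h4 := (div_lt_iff₀ h1).1 (hlt n)
  have h5 := (card_sdiff_le_symmDiff (P n) (C n)).2
  have h6 : 0 < 2 * ε n := lt_of_le_of_lt (by positivity) (hlt n)
  rw [Real.norm_of_nonneg (sub_nonneg.2 (div_le_one_of_le₀ h3 h2.le)), one_sub_div h2.ne',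
    div_le_iff₀ h2]
  nlinarith

end Cardinality

theorem one_lt_card_block (h : 𝒯.IsCF) (n : ℕ) {j : ℕ} (hj : 0 < j) :
    1 < (𝒯.block n j).card := by
  obtain ⟨j, rfl⟩ := Nat.exists_eq_add_of_le' hj
  rw [card_block_succ h.toIsWeakCF]
  exact (h.one_lt_card_C _).trans_le
    (Nat.le_mul_of_pos_left _ (block_nonempty h.toIsWeakCF n j).card_pos)

namespace LinkingData

variable {D : LinkingData 𝒯 𝒯'} {φ : ActionIso 𝒯 𝒯'} {ε : ℕ → ℝ}

theorem k_le_succ (D : LinkingData 𝒯 𝒯') (n : ℕ) : D.k n ≤ D.k (n + 1) := by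
  rcases n with _ | n
  · rw [D.k_zero]
    exact Nat.zero_le _
  · exact ((D.k_lt_l _ n.succ_pos).trans (D.l_lt_k _ n.succ_pos)).le

theorem l_lt_succ (D : LinkingData 𝒯 𝒯') (n : ℕ) : D.l n < D.l (n + 1) := by
  rcases n with _ | n
  · rw [D.l_zero]
    exact (Nat.zero_le _).trans_lt (D.k_lt_l 1 le_rfl)
  · exact (D.l_lt_k _ n.succ_pos).trans (D.k_lt_l _ (Nat.succ_pos _))

namespace IsProducedFrom

theorem J'_nonempty (hD : D.IsProducedFrom φ ε) (n : ℕ) : (D.J' n).Nonempty :=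
  ((hD.A_nonempty n).mono Finset.inter_subset_left).of_mul_left

theorem J_nonempty (hD : D.IsProducedFrom φ ε) (n : ℕ) : (D.J (n + 1)).Nonempty :=
  ((hD.A_nonempty n).mono Finset.inter_subset_left).of_mul_right

theorem isWeakCF_V (hD : D.IsProducedFrom φ ε) (h : 𝒯.IsCF) (hε : Summable ε) :
    D.V.IsWeakCF where
  card_F_zero := by
    change (𝒯.F (D.k 0)).card = 1
    rw [D.k_zero, h.card_F_zero]
  C_nonempty n := (hD.J'_nonempty n).mul (hD.J_nonempty n)
  eventually_one_lt_card_C := by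
    refine eventually_one_lt_card (fun n => block_nonempty h.toIsWeakCF _ _) ?_ hε
      hD.card_symmDiff_lt
    -- Since `k 0 = k 1`, the block of index `0` is `{1}`; it has to be excluded.
    filter_upwards [eventually_ge_atTop 1] with n hn
    exact one_lt_card_block h _ (Nat.sub_pos_of_lt ((D.k_lt_l n hn).trans (D.l_lt_k n hn)))
  mul_subset n := by
    change 𝒯.F (D.k n) * (D.J' n * D.J (n + 1)) ⊆ 𝒯.F (D.k (n + 1))
    rw [← mul_assoc]
    exact (Finset.mul_subset_mul_right (D.mul_J'_subset n)).trans (D.mul_J_subset n)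
  disjoint n := disjoint_mul_singleton_of_injOn (D.mul_J'_subset n) (D.mul_J'_injOn n)
    (D.mul_J_injOn n)

theorem isWeakCF_W (hD : D.IsProducedFrom φ ε) (h' : 𝒯'.IsCF) (hε : Summable ε) :
    D.W.IsWeakCF where
  card_F_zero := by
    change (𝒯'.F (D.l 0)).card = 1
    rw [D.l_zero, h'.card_F_zero]
  C_nonempty n := (hD.J_nonempty n).mul (hD.J'_nonempty (n + 1))
  eventually_one_lt_card_C := eventually_one_lt_card (fun n => block_nonempty h'.toIsWeakCF _ _)
    (Eventually.of_forall fun n => one_lt_card_block h' _ (Nat.sub_pos_of_lt (D.l_lt_succ n))) hε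
    hD.card_symmDiff_lt'
  mul_subset n := by
    change 𝒯'.F (D.l n) * (D.J (n + 1) * D.J' (n + 1)) ⊆ 𝒯'.F (D.l (n + 1))
    rw [← mul_assoc]
    exact (Finset.mul_subset_mul_right (D.mul_J_subset n)).trans (D.mul_J'_subset (n + 1))
  disjoint n := disjoint_mul_singleton_of_injOn (D.mul_J_subset n) (D.mul_J_injOn n)
    (D.mul_J'_injOn (n + 1))

theorem isReduction_A (hD : D.IsProducedFrom φ ε) (h : 𝒯.IsWeakCF) (hε : Summable ε) :
    (𝒯.telescope D.k).IsReduction D.A where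
  nonempty := hD.A_nonempty
  subset _ := Finset.inter_subset_right
  summable := summable_one_sub_card_inter_div (fun _ => block_nonempty h _ _) hε
    hD.card_symmDiff_lt

theorem isReduction_V (hD : D.IsProducedFrom φ ε) (h : 𝒯.IsWeakCF) (hε : Summable ε) :
    D.V.IsReduction D.A where
  nonempty := hD.A_nonempty
  subset _ := Finset.inter_subset_left
  summable := summable_one_sub_card_inter_div' (fun _ => block_nonempty h _ _) hε
    hD.card_symmDiff_lt

theorem isReduction_B (hD : D.IsProducedFrom φ ε) (h' : 𝒯'.IsWeakCF) (hε : Summable ε) :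
    (𝒯'.telescope D.l).IsReduction D.B where
  nonempty := hD.B_nonempty
  subset _ := Finset.inter_subset_right
  summable := summable_one_sub_card_inter_div (fun _ => block_nonempty h' _ _) hε
    hD.card_symmDiff_lt'

theorem isReduction_W (hD : D.IsProducedFrom φ ε) (h' : 𝒯'.IsWeakCF) (hε : Summable ε) :
    D.W.IsReduction D.B where
  nonempty := hD.B_nonempty
  subset _ := Finset.inter_subset_left
  summable := summable_one_sub_card_inter_div' (fun _ => block_nonempty h' _ _) hε
    hD.card_symmDiff_lt'

theorem isChainEquivalent (hD : D.IsProducedFrom φ ε) :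
    CFSeq.IsChainEquivalent D.V D.W D.J' (fun n => D.J (n + 1)) where
  mul_eq _ := rfl
  mul_eq' _ := rfl
  subset' n := D.mul_J_subset n
  subset n := D.mul_J'_subset n
  inter n := inv_mul_inter_mul_inv_eq (D.J'_subset n) (D.mul_J_injOn n) (hD.J_nonempty n)
    (hD.J'_nonempty n)
  inter' n := inv_mul_inter_mul_inv_eq (D.J_subset (n + 1)) (D.mul_J'_injOn (n + 1))
    (hD.J'_nonempty (n + 1)) (hD.J_nonempty n)

end IsProducedFrom

/-! ### The isomorphism as a composition of elementary maps -/

theorem leftFactor_eq (D : LinkingData 𝒯 𝒯') {n : ℕ} {a b : G} (ha : a ∈ D.J' n)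
    (hb : b ∈ D.J (n + 1)) : leftFactor (D.J' n) (D.J (n + 1)) (a * b) = a := by
  have hex : ∃ a' ∈ D.J' n, ∃ b' ∈ D.J (n + 1), a * b = a' * b' := ⟨a, ha, b, hb, rfl⟩
  rw [leftFactor, dif_pos hex]
  obtain ⟨ha', b', hb', e⟩ := hex.choose_spec
  have h1 := @D.mul_J_injOn n (a, b) (Finset.mem_coe.2 (Finset.mem_product.2
    ⟨D.J'_subset n ha, hb⟩)) (hex.choose, b') (Finset.mem_coe.2 (Finset.mem_product.2
    ⟨D.J'_subset n ha', hb'⟩)) e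
  exact (Prod.mk.inj h1).1.symm

theorem eq_of_telescopeMap (h' : 𝒯'.IsWeakCF) {l : ℕ → ℕ} (hl : Tendsto l atTop atTop)
    {y y' : 𝒯'.Space} (e : y.1.compTendsto l hl = y'.1.compTendsto l hl) : y = y' := by
  obtain ⟨N, v, hv, hyv⟩ := exists_path y
  obtain ⟨N', v', hv', hyv'⟩ := exists_path y'
  rw [hyv, hyv', Germ.coe_compTendsto, Germ.coe_compTendsto, Germ.coe_eq] at e
  refine Subtype.ext ?_
  rw [hyv, hyv']
  refine Germ.coe_eq.2 (eventually_atTop.2 ⟨max N N', fun n hn => ?_⟩)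
  obtain ⟨m, hm, hmn⟩ := ((Filter.EventuallyEq.eventually e).and (hl.eventually_ge_atTop n)).exists
  exact (hv.mono h' (le_max_left N N')).eq_of_le (hv'.mono h' (le_max_right N N')) h' hm hn hmn

/-- From some index on, `u ∘ k` is a path for the telescoping, for `V` and for their common
reduction, and likewise `v ∘ l`. The reductions keep the germ, so their inverses are immediate; only
the inverse of the last telescoping uses injectivity. -/
theorem mem_composition (D : LinkingData 𝒯 𝒯') (h : 𝒯.IsWeakCF) (h' : 𝒯'.IsWeakCF)
    {x : 𝒯.Space} {y : 𝒯'.Space} {u v : ℕ → G} {N M : ℕ} (hu : 𝒯.IsPath u N)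
    (hx : x.1 = (u : Germ (atTop : Filter ℕ) G)) (hv : 𝒯'.IsPath v M)
    (hy : y.1 = (v : Germ (atTop : Filter ℕ) G))
    (hJ' : ∀ᶠ n in atTop, (u (D.k n))⁻¹ * v (D.l n) ∈ D.J' n)
    (hJ : ∀ᶠ n in atTop, (v (D.l n))⁻¹ * u (D.k (n + 1)) ∈ D.J (n + 1)) :
    y ∈ D.composition x := by
  obtain ⟨K, hK⟩ := eventually_atTop.1 ((hJ'.and hJ).and
    ((D.tendsto_k.eventually_ge_atTop N).and (D.tendsto_l.eventually_ge_atTop M)))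
  have hA : (D.V.reduce D.A).IsPath (u ∘ D.k) K := by
    refine ⟨hu.mem_F h (hK K le_rfl).2.1, fun n hn => Finset.mem_inter.2 ⟨?_, ?_⟩⟩
    · have := Finset.mul_mem_mul (hK n hn).1.1 (hK n hn).1.2
      rwa [mul_assoc, mul_inv_cancel_left] at this
    · have := hu.mem_block (hK n hn).2.1 (D.k (n + 1) - D.k n)
      rwa [Nat.add_sub_cancel' (D.k_le_succ n)] at this
  have hB : (D.W.reduce D.B).IsPath (v ∘ D.l) K := by
    refine ⟨hv.mem_F h' (hK K le_rfl).2.2, fun n hn => Finset.mem_inter.2 ⟨?_, ?_⟩⟩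
    · have := Finset.mul_mem_mul (hK n hn).1.2 (hK (n + 1) (by omega)).1.1
      rwa [mul_assoc, mul_inv_cancel_left] at this
    · have := hv.mem_block (hK n hn).2.2 (D.l (n + 1) - D.l n)
      rwa [Nat.add_sub_cancel' (D.l_lt_succ n).le] at this
  have hTk : (𝒯.telescope D.k).IsPath (u ∘ D.k) K :=
    ⟨hA.mem, fun n hn => (Finset.mem_inter.1 (hA.step n hn)).2⟩
  have hV : D.V.IsPath (u ∘ D.k) K :=
    ⟨hA.mem, fun n hn => (Finset.mem_inter.1 (hA.step n hn)).1⟩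
  have hTl : (𝒯'.telescope D.l).IsPath (v ∘ D.l) K :=
    ⟨hB.mem, fun n hn => (Finset.mem_inter.1 (hB.step n hn)).2⟩
  have hW : D.W.IsPath (v ∘ D.l) K :=
    ⟨hB.mem, fun n hn => (Finset.mem_inter.1 (hB.step n hn)).1⟩
  have hchain : ((v ∘ D.l : ℕ → G) : Germ (atTop : Filter ℕ) G) =
      chainGerm D.J' (fun n => D.J (n + 1)) ((u ∘ D.k : ℕ → G) : Germ (atTop : Filter ℕ) G) := by
    refine Germ.coe_eq.2 (eventually_atTop.2 ⟨K, fun n hn => ?_⟩)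
    have e : (u (D.k n))⁻¹ * u (D.k (n + 1)) =
        ((u (D.k n))⁻¹ * v (D.l n)) * ((v (D.l n))⁻¹ * u (D.k (n + 1))) := by
      rw [mul_assoc, mul_inv_cancel_left]
    simp only [Function.comp_apply]
    rw [e, D.leftFactor_eq (hK n hn).1.1 (hK n hn).1.2, mul_inv_cancel_left]
  -- The intermediate points are listed from the last map back to the first; the goals then appear
  -- in the order in which the maps are applied.
  refine Part.mem_bind_iff.2 ⟨hTl.point, Part.mem_bind_iff.2 ⟨hB.point, Part.mem_bind_iff.2
    ⟨hW.point, Part.mem_bind_iff.2 ⟨hV.point, Part.mem_bind_iff.2 ⟨hA.point, Part.mem_bind_iff.2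
    ⟨hTk.point, ?_, ?_⟩, ?_⟩, ?_⟩, ?_⟩, ?_⟩, ?_⟩
  · exact mem_partialMap.2 (by rw [hx]; rfl)
  · exact mem_partialMap.2 rfl
  · exact mem_partialInverse.2 ⟨mem_partialMap.2 rfl, fun a ha =>
      Subtype.ext (mem_partialMap.1 ha).symm⟩
  · exact mem_partialMap.2 hchain
  · exact mem_partialMap.2 rfl
  · exact mem_partialInverse.2 ⟨mem_partialMap.2 rfl, fun a ha =>
      Subtype.ext (mem_partialMap.1 ha).symm⟩
  · have hyl : hTl.point.1 = y.1.compTendsto D.l D.tendsto_l := by rw [hy]; rfl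
    exact mem_partialInverse.2 ⟨mem_partialMap.2 hyl, fun a ha =>
      eq_of_telescopeMap h' D.tendsto_l ((mem_partialMap.1 ha).symm.trans hyl)⟩

end LinkingData

/-! ### Borel–Cantelli and the formula for the isomorphism -/

namespace ActionIso

theorem haar_sdiff_le (φ : ActionIso 𝒯 𝒯') (h : 𝒯.IsStandard) (h' : 𝒯'.IsStandard) {k l : ℕ}
    {J' : Finset G} (hmul : 𝒯.F k * J' ⊆ 𝒯'.F l) {f : G} (hf : f ∈ 𝒯.F k) :
    𝒯.haar (𝒯.cylinder k {f} \ φ.toFun ⁻¹' 𝒯'.cylinder l (f • J')) ≤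
      𝒯.haar (𝒯.cylinder k {1} ∆ (φ.toFun ⁻¹' 𝒯'.cylinder l J')) := by
  have hm : MeasurableSet (𝒯.cylinder k {f} \ φ.toFun ⁻¹' 𝒯'.cylinder l (f • J')) :=
    (measurableSet_cylinder _ _).diff (φ.quasi.measurable (measurableSet_cylinder _ _))
  rw [← (h.measurePreserving_actFun f).measure_preimage hm.nullMeasurableSet]
  have hs : f • ({1} : Finset G) = {f} := by simp
  have h1 := h.ae_mem_cylinder_smul_iff (g := f) (n := k)
    (Finset.singleton_subset_iff.2 (h.one_mem_F k))
    (by rw [hs]; exact Finset.singleton_subset_iff.2 hf)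
  have h2 := φ.ae_toFun_mem_cylinder_iff h h' (g := f) (n := l) (A := J')
    (fun s hs => hmul (by simpa using Finset.mul_mem_mul (h.one_mem_F k) hs))
    ((Finset.smul_finset_subset_mul hf).trans hmul)
  rw [hs] at h1
  refine measure_mono_ae ?_
  filter_upwards [h1, h2] with x hx1 hx2 hx
  exact Or.inl ⟨hx1.1 hx.1, fun hx' => hx.2 (hx2.2 hx')⟩

/-- By equivariance each level `[f]_{k_n}` fails on a set of measure at most `ε n μ([f]_{k_n})`.
Inside a fixed `X_m` this sums to at most `ε n μ(X_m)`, and Borel–Cantelli applies. -/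
theorem ae_eventually_linked (φ : ActionIso 𝒯 𝒯') (h : 𝒯.IsStandard) (h' : 𝒯'.IsStandard)
    {k l : ℕ → ℕ} {J' : ℕ → Finset G} {ε : ℕ → ℝ} (hk : Tendsto k atTop atTop)
    (hmul : ∀ n, 𝒯.F (k n) * J' n ⊆ 𝒯'.F (l n)) (hε : Summable ε)
    (hsymm : ∀ n, 1 ≤ n → 𝒯.haar (𝒯.cylinder (k n) {1} ∆
      (φ.toFun ⁻¹' 𝒯'.cylinder (l n) (J' n))) <
        ENNReal.ofReal (ε n) * 𝒯.haar (𝒯.cylinder (k n) {1})) :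
    ∀ᵐ x ∂𝒯.haar, ∀ᶠ n in atTop,
      ∃ f, x ∈ 𝒯.cylinder (k n) {f} ∧ φ.toFun x ∈ 𝒯'.cylinder (l n) (f • J' n) := by
  have hw := h.toIsWeakCF
  refine ae_of_forall_cylinder fun m => ?_
  let p : ℕ → 𝒯.Space → Prop := fun n x => x ∈ 𝒯.cylinder m (𝒯.F m) ∧ (1 ≤ n ∧ m ≤ k n) ∧
    ¬∃ f, x ∈ 𝒯.cylinder (k n) {f} ∧ φ.toFun x ∈ 𝒯'.cylinder (l n) (f • J' n)
  have hp : ∀ n, 𝒯.haar {x | p n x} ≤ ENNReal.ofReal (ε n) * 𝒯.haar (𝒯.cylinder m (𝒯.F m)) := by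
    intro n
    by_cases hn : 1 ≤ n ∧ m ≤ k n
    · have hsub := mul_block_subset' hw hn.2 (subset_refl (𝒯.F m))
      calc 𝒯.haar {x | p n x}
          ≤ 𝒯.haar (⋃ f ∈ 𝒯.F m * 𝒯.block m (k n - m),
              𝒯.cylinder (k n) {f} \ φ.toFun ⁻¹' 𝒯'.cylinder (l n) (f • J' n)) := by
            refine measure_mono ?_
            rintro x ⟨hx, -, hx'⟩
            rw [← cylinder_of_le hw hn.2 subset_rfl, cylinder_eq_biUnion, Set.mem_iUnion₂] at hx
            obtain ⟨f, hf, hxf⟩ := hx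
            exact Set.mem_iUnion₂.2 ⟨f, hf, hxf, fun hφ => hx' ⟨f, hxf, hφ⟩⟩
        _ ≤ ∑ f ∈ 𝒯.F m * 𝒯.block m (k n - m),
              𝒯.haar (𝒯.cylinder (k n) {f} \ φ.toFun ⁻¹' 𝒯'.cylinder (l n) (f • J' n)) :=
            measure_biUnion_finset_le _ _
        _ ≤ ∑ f ∈ 𝒯.F m * 𝒯.block m (k n - m),
              ENNReal.ofReal (ε n) * 𝒯.haar (𝒯.cylinder (k n) {f}) := by
            refine Finset.sum_le_sum fun f hf => ?_
            refine (φ.haar_sdiff_le h h' (hmul n) (hsub hf)).trans ((hsymm n hn.1).le.trans_eq ?_)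
            rw [haar_cylinder_singleton hw (hsub hf), haar_cylinder_singleton hw (h.one_mem_F _)]
        _ = _ := by
            rw [← Finset.mul_sum, ← measure_cylinder hw, cylinder_of_le hw hn.2 subset_rfl]
    · have : {x | p n x} = ∅ := Set.eq_empty_of_forall_notMem fun x hx => hn hx.2.1
      rw [this, measure_empty]
      exact zero_le
  have hsum : ∑' n, 𝒯.haar {x | p n x} ≠ ⊤ := by
    refine ne_top_of_le_ne_top ?_ (ENNReal.tsum_le_tsum hp)
    rw [ENNReal.tsum_mul_right]
    exact ENNReal.mul_ne_top hε.tsum_ofReal_ne_top (haar_cylinder_ne_top hw m _)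
  refine measure_mono_null (fun x hx => ?_) (measure_setOfPred_frequently_eq_zero hsum)
  refine (not_eventually.1 hx.2).mp ?_
  filter_upwards [eventually_ge_atTop 1, hk.eventually_ge_atTop m] with n h1 h2 h3
  exact ⟨hx.1, ⟨h1, h2⟩, h3⟩

theorem ae_mem_composition (φ : ActionIso 𝒯 𝒯') (h : 𝒯.IsStandard) (h' : 𝒯'.IsStandard)
    {D : LinkingData 𝒯 𝒯'} {ε : ℕ → ℝ} (hε : Summable ε) (hD : D.IsProducedFrom φ ε) :
    ∀ᵐ x ∂𝒯.haar, φ.toFun x ∈ D.composition x := by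
  have h1 := φ.ae_eventually_linked h h' D.tendsto_k D.mul_J'_subset hε hD.haar_symmDiff_lt
  -- For the inverse, `[1]_{l_n}` is paired with `J_{n+1}`, so the errors are those of index `n +
  -- 1`.
  have h2 := (φ.symm h).ae_eventually_linked h' h D.tendsto_l D.mul_J_subset
    ((summable_nat_add_iff 1).2 hε) hD.haar_symmDiff_lt'
  filter_upwards [h1, φ.quasi.ae h2, φ.left_inv] with x hx1 hx2 hx3
  change ∀ᶠ n in atTop, ∃ f, φ.toFun x ∈ 𝒯'.cylinder (D.l n) {f} ∧
    φ.invFun (φ.toFun x) ∈ 𝒯.cylinder (D.k (n + 1)) (f • D.J (n + 1)) at hx2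
  rw [hx3] at hx2
  obtain ⟨N, u, hu, hxu⟩ := exists_path x
  obtain ⟨M, v, hv, hyv⟩ := exists_path (φ.toFun x)
  have hkN := D.tendsto_k.eventually_ge_atTop N
  have hlM := D.tendsto_l.eventually_ge_atTop M
  refine D.mem_composition h.toIsWeakCF h'.toIsWeakCF hu hxu hv hyv ?_ ?_
  · filter_upwards [hx1, hkN, hlM] with n ⟨f, hf1, hf2⟩ hn hn'
    -- The level `f` containing `x` is its coordinate `u (k n)`, so `φ x ∈ [f J'_n]` says that `(u
    -- (k n))⁻¹ * v (l n) ∈ J'_n`.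
    rw [mem_cylinder_iff h.toIsWeakCF hu hxu hn, Finset.mem_singleton] at hf1
    rw [mem_cylinder_iff h'.toIsWeakCF hv hyv hn', ← Finset.inv_smul_mem_iff] at hf2
    rwa [hf1]
  · filter_upwards [hx2, (tendsto_add_atTop_nat 1).eventually hkN, hlM] with n ⟨f, hf1, hf2⟩ hn hn'
    rw [mem_cylinder_iff h'.toIsWeakCF hv hyv hn', Finset.mem_singleton] at hf1
    rw [mem_cylinder_iff h.toIsWeakCF hu hxu hn, ← Finset.inv_smul_mem_iff] at hf2
    rwa [hf1]

end ActionIso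

end CFSeq

theorem theorem2p2 {G : Type*} [Group G] [Countable G] [DecidableEq G] (𝒯 𝒯' : CFSeq G)
    (h𝒯 : 𝒯.IsCF) (hact : 𝒯.IsMeasurePreserving) (hnorm : 𝒯.IsNormalized)
    (h𝒯' : 𝒯'.IsCF) (hact' : 𝒯'.IsMeasurePreserving) (hnorm' : 𝒯'.IsNormalized)
    (ε : ℕ → ℝ) (hε_anti : Antitone ε) (hε_pos : ∀ n, 0 < ε n) (hε_one : 1 < ε 1)
    (hε_summable : Summable ε) (hε_sum : ∑' n, ε (n + 2) < 1 / 3)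
    (φ : CFSeq.ActionIso 𝒯 𝒯') :
    (∃ D : CFSeq.LinkingData 𝒯 𝒯', D.IsProducedFrom φ ε) ∧
    ∀ D : CFSeq.LinkingData 𝒯 𝒯', D.IsProducedFrom φ ε →
      D.V.IsWeakCF ∧ D.W.IsWeakCF ∧
      (𝒯.telescope D.k).IsReduction D.A ∧ D.V.IsReduction D.A ∧
      (𝒯'.telescope D.l).IsReduction D.B ∧ D.W.IsReduction D.B ∧
      CFSeq.IsChainEquivalent D.V D.W D.J' (fun n => D.J (n + 1)) ∧
      ∀ᵐ x ∂𝒯.haar, φ.toFun x ∈ D.composition x := by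
  have h : 𝒯.IsStandard := ⟨h𝒯, hact, hnorm⟩
  have h' : 𝒯'.IsStandard := ⟨h𝒯', hact', hnorm'⟩
  refine ⟨CFSeq.exists_linkingData φ h h' hε_anti hε_pos hε_one, fun D hD => ?_⟩
  exact ⟨hD.isWeakCF_V h𝒯 hε_summable, hD.isWeakCF_W h𝒯' hε_summable,
    hD.isReduction_A h.toIsWeakCF hε_summable, hD.isReduction_V h.toIsWeakCF hε_summable,
    hD.isReduction_B h'.toIsWeakCF hε_summable, hD.isReduction_W h'.toIsWeakCF hε_summable,
    hD.isChainEquivalent, φ.ae_mem_composition h h' hε_summable hD⟩
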